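/- Let $\theta>0$ and let $M(a,c,x)=\sum_{j\ge 0}\frac{(a)_j}{(c)_j}\frac{x^j}{j!}$ be Kummer's hypergeometric function, with $D_aM$ its partial derivative in the first parameter. For every integer $k\ge 1$ the equation $$\theta\, D_aM(k,\theta+k,x)-M(k,\theta+k,x)=0$$ has exactly one root $x=\gamma_k$ in $(0,\infty)$; these $\gamma_k$ depend only on $\theta$ and $k$. Let $\Lambda:[0,1]\to\mathbb R$ be continuous and nondecreasing with $\Lambda(0)=0$ (for instance $\Lambda(s)=\int_0^s\lambda(u)\,du$ for an integrable intensity $\lambda\ge 0$), and let trials arrive at the epochs $T_1,T_2,\dots$ of an inhomogeneous Poisson process $(N_t,\ t\in[0,1])$ with mean function $\Lambda$. The $k$th trial ($k\ge1$) is a success with probability $p_k=\theta/(\theta+k-1)$, independently of the other trials and of $(N_t)$. Let $\mathcal F_t$ be the $\sigma$-algebra generated by the arrival epochs and the outcomes of the trials in $[0,t]$. A stopping strategy is a random time $\tau$ with values in $\{T_1,\dots,T_{N_1},1\}$ such that $\{\tau\le t\}\in\mathcal F_t$ for all $t\in[0,1]$, where $\tau=1$ means that no trial is selected. It wins if it stops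 before time $1$ at a trial that is a success and no later trial is a success. Then the strategy that stops at the first success (the $k$th trial, arriving at time $t$, say) for which $$\Lambda(1)-\Lambda(t)\le\gamma_k ,$$ and selects no trial if there is no such success, is a stopping strategy and has the largest winning probability among all stopping strategies. -/

import Mathlib

open MeasureTheory ProbabilityTheory

noncomputable section

namespace LastSuccess

/-- Kummer's confluent hypergeometric function
`M(a, c, x) = ∑ j, (a)_j / (c)_j * x ^ j / j!`. -/
def kummer (a c x : ℝ) : ℝ :=
  ∑' j : ℕ, (ascPochhammer ℝ j).eval a / (ascPochhammer ℝ j).eval c * (x ^ j / (j.factorial : ℝ))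

/-- `x` is a positive root of `θ * D_a M(k, θ + k, x) - M(k, θ + k, x) = 0`, where `D_a` is the
partial derivative in the first parameter (the second parameter `θ + k` is held fixed). -/
def IsCriticalRoot (θ : ℝ) (k : ℕ) (x : ℝ) : Prop :=
  0 < x ∧ θ * deriv (fun a : ℝ => kummer a (θ + k) x) (k : ℝ) - kummer k (θ + k) x = 0

variable {Ω : Type*}

/-- `N` is the counting process, on the time interval `[0, 1]`, of an inhomogeneous Poisson
process with mean function `Λ`: it starts at `0`, has nondecreasing right-continuous paths and
independent increments, and `N t - N s` is Poisson with mean `Λ t - Λ s` for `s ≤ t`. -/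
structure IsPoissonProcess [MeasurableSpace Ω] (P : Measure Ω) (Λ : unitInterval → ℝ)
    (N : unitInterval → Ω → ℕ) : Prop where
  measurable : ∀ t, Measurable (N t)
  start : ∀ ω, N 0 ω = 0
  mono : ∀ ω, Monotone fun t => N t ω
  rightCont : ∀ ω t, ContinuousWithinAt (fun s => N s ω) (Set.Ici t) t
  indep : HasIndepIncrements N P
  law : ∀ s t, s ≤ t →
    HasLaw (fun ω => N t ω - N s ω) (poissonMeasure (Λ t - Λ s).toNNReal) P

/-- Trials arrive at the jumps of a Poisson process `N` with mean function `Λ`. The `k`-th trial,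
`k ≥ 1`, is a success (`X k = true`) with probability `θ / (θ + k - 1)`, independently of the
other trials and of the arrival process. The value `X 0` plays no role. -/
structure IsModel [MeasurableSpace Ω] (P : Measure Ω) (θ : ℝ) (Λ : unitInterval → ℝ)
    (N : unitInterval → Ω → ℕ) (X : ℕ → Ω → Bool) : Prop where
  poisson : IsPoissonProcess P Λ N
  measurable : ∀ k, 1 ≤ k → Measurable (X k)
  profile : ∀ k, 1 ≤ k → P {ω | X k ω = true} = ENNReal.ofReal (θ / (θ + k - 1))
  indep : iIndepFun (fun n : ℕ => X (n + 1)) P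
  indep_arrivals : IndepFun (fun ω (t : unitInterval) => N t ω) (fun ω (n : ℕ) => X (n + 1) ω) P

/-- The epoch `T_k` of the `k`-th arrival, meaningful if `1 ≤ k ≤ N 1 ω`. -/
def arrivalTime (N : unitInterval → Ω → ℕ) (k : ℕ) (ω : Ω) : unitInterval :=
  sInf {t | k ≤ N t ω}

/-- The natural filtration: the σ-algebra generated, for all `s ≤ t`, by the number `N s` of
arrivals and by the outcomes of the trials number `1, …, N s`. -/
abbrev history (N : unitInterval → Ω → ℕ) (X : ℕ → Ω → Bool) (t : unitInterval) :
    MeasurableSpace Ω :=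
  ⨆ (s : unitInterval) (_ : s ≤ t),
    MeasurableSpace.comap
      (fun ω => ((N s ω, fun n : ℕ => decide (n + 1 ≤ N s ω) && X (n + 1) ω) : ℕ × (ℕ → Bool)))
      inferInstance

/-- Stopping strategies: random times adapted to the natural filtration with values in
`{T_1, …, T_{N 1}, 1}`, where the value `1` means that no trial is selected. -/
structure IsStrategy (N : unitInterval → Ω → ℕ) (X : ℕ → Ω → Bool) (τ : Ω → unitInterval) :
    Prop where
  adapted : ∀ t, MeasurableSet[history N X t] {ω | τ ω ≤ t}
  values : ∀ ω, τ ω = 1 ∨ ∃ k, 1 ≤ k ∧ k ≤ N 1 ω ∧ τ ω = arrivalTime N k ω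

/-- The event that `τ` selects the last success: it stops before time `1` at a trial which is a
success, and no later trial is a success. -/
def winEvent (N : unitInterval → Ω → ℕ) (X : ℕ → Ω → Bool) (τ : Ω → unitInterval) : Set Ω :=
  {ω | τ ω < 1 ∧ ∃ k, 1 ≤ k ∧ k ≤ N 1 ω ∧ τ ω = arrivalTime N k ω ∧ X k ω = true ∧
    ∀ j, k < j → j ≤ N 1 ω → X j ω = false}

/-- Stop at the first success state `(t, k)` (the `k`-th trial arrives at time `t` and is a
success) with `Λ 1 - Λ t ≤ γ k`. If there is none, the infimum is over `∅` and equals `1`, which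
means that no trial is selected. -/
def thresholdRule (Λ : unitInterval → ℝ) (γ : ℕ → ℝ) (N : unitInterval → Ω → ℕ)
    (X : ℕ → Ω → Bool) (ω : Ω) : unitInterval :=
  sInf {t | ∃ k, 1 ≤ k ∧ k ≤ N 1 ω ∧ t = arrivalTime N k ω ∧ X k ω = true ∧ Λ 1 - Λ t ≤ γ k}

end LastSuccess

end

/-!
The problem is a monotone one, and the threshold rule is its one-step look-ahead rule.

**The roots.** The probability that none of the trials `k + 1, …, k + j` is a success is
`(k)_j / (θ + k)_j`, and the probability that exactly one is equals this number times
`θ (1 / k + ⋯ + 1 / (k + j - 1))`, the sum of the odds. Hence, with `x = Λ 1 - Λ t` the mean number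
of later trials, `e^{-x} (θ D_a M(k, θ + k, x) - M(k, θ + k, x))` is the conditional probability
of exactly one later success minus that of none, given that the `k`-th trial arrives at time `t`;
this is `gain`. The power series in the bracket has coefficients `gainCoeff`, which change sign
once, from `-` to `+`, so it has exactly one positive root `γ k`
(`existsUnique_egf_gainCoeff_eq_zero`).

**Monotonicity.** The roots increase with `k` (`IsCriticalRoot.le_succ`), because
`R k = D_a M / M` decreases in `k` (`egf_ratio_antitone`). The contiguity relation of
`M(k, θ + k, x)` with its two successors and the derivative of this relation in the parameter
combine to `R k - R (k + 1) = α * (1 / (k + 1) - (R (k + 1) - R (k + 2)))` with `α ≥ 0`, and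
`R (k + 1) - R (k + 2) ≤ 1 / (k + 1)` is Chebyshev's sum inequality (`chebyshev_egf`).

**Optimality.** Almost surely there are no simultaneous arrivals. Then a strategy `τ` that wins has
passed over the last success but one (or there is none) and not over the last success, so
`P(win) ≤ P(exactly one success) + P(last but one is passed) - P(last is passed)`, with equality
for the threshold rule, which stops at successes only (`IsModel.measureReal_winEvent_add_le`,
`IsModel.le_measureReal_winEvent_thresholdRule_add`). By the Markov property
(`IsModel.measureReal_passed_sub`), the difference of the last two terms is the expectation of the
sum of `gain` over all successes passed over by `τ`. As `Λ` and `γ` are monotone, `gain` is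
nonnegative at the successes passed over by the threshold rule and nonpositive at all others
(`IsModel.setIntegral_gain_le`), so no strategy collects more.

The Markov property at the random epoch of the `k`-th trial is derived from independence at fixed
times (`IsModel.hasSum_measureReal_inter`) by means of fine grids of the time interval, outside
the event `crowded`, which has small probability.
-/

namespace LastSuccess

/-! ### Exponential generating functions and sign changes -/

/-- The exponential generating function of the sequence `f`. -/
noncomputable def egf (f : ℕ → ℝ) (x : ℝ) : ℝ := ∑' j : ℕ, f j * (x ^ j / (j.factorial : ℝ))

lemma summable_egf {f : ℕ → ℝ} {C r : ℝ} (hf : ∀ j, |f j| ≤ C * r ^ j) (x : ℝ) :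
    Summable fun j : ℕ => f j * (x ^ j / (j.factorial : ℝ)) := by
  refine Summable.of_norm_bounded
    ((Real.summable_pow_div_factorial (r * |x|)).mul_left C) fun j => ?_
  rw [Real.norm_eq_abs, abs_mul, abs_div, abs_pow, Nat.abs_cast, mul_pow]
  calc |f j| * (|x| ^ j / (j.factorial : ℝ)) ≤ C * r ^ j * (|x| ^ j / (j.factorial : ℝ)) := by
        gcongr; exact hf j
    _ = _ := by ring

lemma continuous_egf {f : ℕ → ℝ} {C r : ℝ} (hf : ∀ j, |f j| ≤ C * r ^ j) :
    Continuous (egf f) := by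
  rw [continuous_iff_continuousAt]
  intro x₀
  have hs : ContinuousOn (egf f) (Metric.ball 0 (|x₀| + 1)) := by
    refine continuousOn_tsum (fun j => by fun_prop)
      ((Real.summable_pow_div_factorial (r * (|x₀| + 1))).mul_left C) fun j x hx => ?_
    rw [mem_ball_zero_iff, Real.norm_eq_abs] at hx
    rw [Real.norm_eq_abs, abs_mul, abs_div, abs_pow, Nat.abs_cast, mul_pow]
    calc |f j| * (|x| ^ j / (j.factorial : ℝ))
        ≤ C * r ^ j * ((|x₀| + 1) ^ j / (j.factorial : ℝ)) := by
          gcongr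
          · exact (abs_nonneg _).trans (hf j)
          · exact hf j
      _ = _ := by ring
  exact hs.continuousAt (Metric.isOpen_ball.mem_nhds (by simp))

lemma egf_zero (f : ℕ → ℝ) : egf f 0 = f 0 := by
  rw [egf, tsum_eq_single 0]
  · simp
  · intro j hj; simp [hj]

/-- Multiplying an exponential generating function by `x` shifts its coefficients. -/
lemma hasSum_egf_mul {f : ℕ → ℝ} {x s : ℝ}
    (h : HasSum (fun j : ℕ => f j * (x ^ j / (j.factorial : ℝ))) s) :
    HasSum (fun j : ℕ => (j * f (j - 1)) * (x ^ j / (j.factorial : ℝ))) (x * s) := by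
  rw [← hasSum_nat_add_iff' 1]
  simp only [Finset.range_one, Finset.sum_singleton, Nat.cast_zero, zero_mul, sub_zero]
  refine (h.mul_left x).congr_fun fun j => ?_
  have : (j.factorial : ℝ) ≠ 0 := by positivity
  simp only [Nat.add_sub_cancel, Nat.factorial_succ, pow_succ]
  push_cast
  field_simp

/-- If the coefficients of a power series change sign exactly once, from `-` to `+` at the
index `m`, then `egf f x / x ^ m` is increasing; so `egf f` stays positive once it is
nonnegative. -/
lemma egf_pos_of_nonneg {f : ℕ → ℝ} {C r : ℝ} (hf : ∀ j, |f j| ≤ C * r ^ j) {m : ℕ} (hm : m ≠ 0)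
    (h0 : f 0 < 0) (hneg : ∀ j < m, f j ≤ 0) (hpos : ∀ j, m ≤ j → 0 ≤ f j) {x y : ℝ} (hx : 0 < x)
    (hxy : x < y) (h : 0 ≤ egf f x) : 0 < egf f y := by
  have hy : 0 < y := hx.trans hxy
  have key : y ^ m * egf f x < x ^ m * egf f y := by
    rw [egf, egf, ← tsum_mul_left, ← tsum_mul_left]
    refine Summable.tsum_lt_tsum (i := 0) (fun j => ?_) ?_ ((summable_egf hf x).mul_left _)
      ((summable_egf hf y).mul_left _)
    · have hj : (0 : ℝ) < j.factorial := by positivity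
      have e1 : y ^ m * (f j * (x ^ j / (j.factorial : ℝ)))
          = f j * (y ^ m * x ^ j) / (j.factorial : ℝ) := by ring
      have e2 : x ^ m * (f j * (y ^ j / (j.factorial : ℝ)))
          = f j * (x ^ m * y ^ j) / (j.factorial : ℝ) := by ring
      rw [e1, e2]
      refine div_le_div_of_nonneg_right ?_ hj.le
      rcases lt_or_ge j m with hjm | hjm
      · refine mul_le_mul_of_nonpos_left ?_ (hneg j hjm)
        obtain ⟨d, rfl⟩ := Nat.exists_eq_add_of_lt hjm
        have : x ^ (d + 1) ≤ y ^ (d + 1) := by gcongr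
        calc x ^ (j + d + 1) * y ^ j = x ^ (d + 1) * (x ^ j * y ^ j) := by ring
          _ ≤ y ^ (d + 1) * (x ^ j * y ^ j) := by gcongr
          _ = _ := by ring
      · refine mul_le_mul_of_nonneg_left ?_ (hpos j hjm)
        obtain ⟨d, rfl⟩ := Nat.exists_eq_add_of_le hjm
        calc y ^ m * x ^ (m + d) = x ^ d * (x ^ m * y ^ m) := by ring
          _ ≤ y ^ d * (x ^ m * y ^ m) := by gcongr
          _ = _ := by ring
    · have : x ^ m < y ^ m := by gcongr
      simp only [pow_zero, Nat.factorial_zero, Nat.cast_one, div_one, mul_one]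
      nlinarith
  have h1 : 0 < x ^ m * egf f y := lt_of_le_of_lt (by positivity) key
  exact pos_of_mul_pos_right h1 (by positivity)

/-- A power series with a single change of sign, from `-` to `+`, is eventually positive: the
terms of order below `m` are bounded below by a multiple of `x ^ m`, which the term of order
`m + 1` outgrows. -/
lemma exists_egf_pos {f : ℕ → ℝ} {C r : ℝ} (hf : ∀ j, |f j| ≤ C * r ^ j) {m : ℕ}
    (hneg : ∀ j < m, f j ≤ 0) (hpos : ∀ j, m ≤ j → 0 ≤ f j) (hm : 0 < f (m + 1)) :
    ∃ y, 0 < y ∧ 0 < egf f y := by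
  set A : ℝ := ∑ j ∈ Finset.range m, f j / (j.factorial : ℝ) with hA
  set B : ℝ := f (m + 1) / ((m + 1).factorial : ℝ) with hB
  have hBpos : 0 < B := by positivity
  obtain ⟨y, hy1, hy⟩ : ∃ y : ℝ, 1 ≤ y ∧ 0 < A + B * y := by
    refine ⟨max 1 ((1 - A) / B), le_max_left _ _, ?_⟩
    have : B * ((1 - A) / B) ≤ B * max 1 ((1 - A) / B) := by gcongr; exact le_max_right _ _
    rw [mul_div_cancel₀ _ hBpos.ne'] at this
    linarith
  have hy0 : 0 < y := by linarith
  refine ⟨y, hy0, ?_⟩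
  have h1 : ∑ j ∈ insert (m + 1) (Finset.range m), f j * (y ^ j / (j.factorial : ℝ)) ≤ egf f y := by
    refine Summable.sum_le_tsum _ (fun j hj => ?_) (summable_egf hf y)
    have : m ≤ j := by
      simp only [Finset.mem_insert, Finset.mem_range, not_or, not_lt] at hj; exact hj.2
    have := hpos j this
    positivity
  rw [Finset.sum_insert (by simp)] at h1
  have h2 : y ^ m * A ≤ ∑ j ∈ Finset.range m, f j * (y ^ j / (j.factorial : ℝ)) := by
    rw [hA, Finset.mul_sum]
    refine Finset.sum_le_sum fun j hj => ?_
    have hj' := Finset.mem_range.1 hj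
    have h3 : f j / (j.factorial : ℝ) ≤ 0 :=
      div_nonpos_of_nonpos_of_nonneg (hneg j hj') (by positivity)
    have h4 : y ^ j ≤ y ^ m := pow_le_pow_right₀ hy1 hj'.le
    calc y ^ m * (f j / (j.factorial : ℝ)) ≤ y ^ j * (f j / (j.factorial : ℝ)) :=
          mul_le_mul_of_nonpos_right h4 h3
      _ = _ := by ring
  have h5 : f (m + 1) * (y ^ (m + 1) / ((m + 1).factorial : ℝ)) = y ^ m * (B * y) := by
    rw [hB]; ring
  have h6 : 0 < y ^ m * (A + B * y) := by positivity
  rw [h5] at h1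
  nlinarith

/-! ### The critical function and its root -/

/-- The probability that none of the trials `k + 1, …, k + j` is a success. -/
noncomputable def survival (θ : ℝ) (k j : ℕ) : ℝ :=
  ∏ i ∈ Finset.range j, ((k : ℝ) + i) / (θ + k + i)

/-- The harmonic sum `1 / k + ⋯ + 1 / (k + j - 1)`. Multiplied by `θ`, it is the sum of the odds
`p / (1 - p)` of the trials `k + 1, …, k + j`. -/
noncomputable def harm (k j : ℕ) : ℝ := ∑ i ∈ Finset.range j, 1 / ((k : ℝ) + i)

/-- The coefficient of `x ^ j / j!` in `θ * D_a M(k, θ + k, x) - M(k, θ + k, x)`: the probability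
that exactly one of the trials `k + 1, …, k + j` is a success, minus the probability that none
is. -/
noncomputable def gainCoeff (θ : ℝ) (k j : ℕ) : ℝ := survival θ k j * (θ * harm k j - 1)

lemma survival_succ (θ : ℝ) (k j : ℕ) :
    survival θ k (j + 1) = survival θ k j * (((k : ℝ) + j) / (θ + k + j)) :=
  Finset.prod_range_succ _ _

lemma survival_succ_left (θ : ℝ) (k j : ℕ) :
    survival θ k (j + 1) = (k : ℝ) / (θ + k) * survival θ (k + 1) j := by
  rw [survival, Finset.prod_range_succ', survival, mul_comm]
  congr 1
  · simp
  · refine Finset.prod_congr rfl fun i _ => ?_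
    push_cast; congr 1 <;> ring

lemma harm_succ (k j : ℕ) : harm k (j + 1) = harm k j + 1 / ((k : ℝ) + j) :=
  Finset.sum_range_succ _ _

lemma harm_succ_left (k j : ℕ) : harm k (j + 1) = 1 / (k : ℝ) + harm (k + 1) j := by
  rw [harm, Finset.sum_range_succ', harm, add_comm]
  congr 1
  · simp
  · refine Finset.sum_congr rfl fun i _ => ?_
    push_cast; congr 1; ring

@[simp] lemma survival_zero (θ : ℝ) (k : ℕ) : survival θ k 0 = 1 := by simp [survival]

@[simp] lemma harm_zero (k : ℕ) : harm k 0 = 0 := by simp [harm]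

section
variable {θ : ℝ} (hθ : 0 < θ) {k : ℕ} (hk : 1 ≤ k)
include hk

lemma harm_strictMono : StrictMono (harm k) :=
  strictMono_nat_of_lt_succ fun j => by
    have : (0 : ℝ) < k := by exact_mod_cast hk
    rw [harm_succ]
    have : 0 < 1 / ((k : ℝ) + j) := by positivity
    linarith

lemma harm_nonneg (j : ℕ) : 0 ≤ harm k j :=
  (harm_zero k).symm.le.trans ((harm_strictMono hk).monotone (Nat.zero_le j))

lemma harm_le (j : ℕ) : harm k j ≤ j := by
  have hk' : (1 : ℝ) ≤ k := by exact_mod_cast hk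
  calc harm k j ≤ ∑ _i ∈ Finset.range j, (1 : ℝ) := by
        refine Finset.sum_le_sum fun i _ => ?_
        have h2 : (0 : ℝ) ≤ i := i.cast_nonneg
        rw [div_le_one (by linarith)]; linarith
    _ = j := by simp

lemma exists_le_harm (r : ℝ) : ∃ j, r ≤ harm k j := by
  have hk' : (1 : ℝ) ≤ k := by exact_mod_cast hk
  have h := Filter.Tendsto.const_mul_atTop (show (0 : ℝ) < 1 / k by positivity)
    Real.tendsto_sum_range_one_div_nat_succ_atTop
  obtain ⟨j, hj⟩ := (h.eventually_ge_atTop r).exists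
  refine ⟨j, hj.trans ?_⟩
  rw [Finset.mul_sum]
  refine Finset.sum_le_sum fun i _ => ?_
  rw [div_mul_div_comm, one_mul]
  have h2 : (0 : ℝ) ≤ i := i.cast_nonneg
  refine div_le_div_of_nonneg_left (by norm_num) (by linarith) ?_
  nlinarith

include hθ

lemma survival_pos (j : ℕ) : 0 < survival θ k j := by
  have : (0 : ℝ) < k := by exact_mod_cast hk
  exact Finset.prod_pos fun i _ => by positivity

lemma survival_le_one (j : ℕ) : survival θ k j ≤ 1 := by
  have : (0 : ℝ) < k := by exact_mod_cast hk
  refine Finset.prod_le_one (fun i _ => by positivity) fun i _ => ?_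
  rw [div_le_one (by positivity)]; linarith

lemma abs_survival_le (j : ℕ) : |survival θ k j| ≤ 1 * 1 ^ j := by
  rw [abs_of_pos (survival_pos hθ hk j)]; simpa using survival_le_one hθ hk j

omit hθ hk in
lemma cast_le_two_pow (j : ℕ) : (j : ℝ) ≤ 2 ^ j := by exact_mod_cast j.lt_two_pow_self.le

lemma abs_survival_mul_harm_le (j : ℕ) : |survival θ k j * harm k j| ≤ 1 * 2 ^ j := by
  rw [abs_of_nonneg (mul_nonneg (survival_pos hθ hk j).le (harm_nonneg hk j))]
  exact mul_le_mul (survival_le_one hθ hk j) ((harm_le hk j).trans (cast_le_two_pow j))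
    (harm_nonneg hk j) zero_le_one

lemma abs_gainCoeff_le (j : ℕ) : |gainCoeff θ k j| ≤ (θ + 1) * 2 ^ j := by
  have h1 := abs_survival_mul_harm_le hθ hk j
  have h2 := abs_survival_le hθ hk j
  have h3 : (1 : ℝ) ≤ 2 ^ j := one_le_pow₀ (by norm_num)
  have e : gainCoeff θ k j = θ * (survival θ k j * harm k j) - survival θ k j := by
    rw [gainCoeff]; ring
  rw [e]
  refine (abs_sub _ _).trans ?_
  rw [abs_mul, abs_of_pos hθ]
  simp only [one_pow, mul_one, one_mul] at h1 h2
  nlinarith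

lemma egf_gainCoeff (x : ℝ) :
    egf (gainCoeff θ k) x
      = θ * egf (fun j => survival θ k j * harm k j) x - egf (survival θ k) x := by
  have h1 := (summable_egf (abs_survival_mul_harm_le hθ hk) x).hasSum
  have h2 := (summable_egf (abs_survival_le hθ hk) x).hasSum
  refine (((h1.mul_left θ).sub h2).congr_fun fun j => ?_).tsum_eq
  rw [gainCoeff]; ring

lemma egf_survival_pos {x : ℝ} (hx : 0 ≤ x) : 0 < egf (survival θ k) x := by
  refine (summable_egf (abs_survival_le hθ hk) x).tsum_pos (fun j => ?_) 0 (by simp)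
  have := survival_pos hθ hk j
  positivity

/-- The coefficients `gainCoeff θ k` change sign exactly once. -/
lemma exists_gainCoeff_sign_change : ∃ m, m ≠ 0 ∧ (∀ j < m, gainCoeff θ k j ≤ 0) ∧
    (∀ j, m ≤ j → 0 ≤ gainCoeff θ k j) ∧ 0 < gainCoeff θ k (m + 1) := by
  classical
  have hex := exists_le_harm hk (1 / θ)
  have hm : 1 / θ ≤ harm k (Nat.find hex) := Nat.find_spec hex
  have key : ∀ j, 1 / θ ≤ harm k j → 0 ≤ θ * harm k j - 1 := fun j hj => by
    rw [div_le_iff₀ hθ] at hj; linarith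
  refine ⟨Nat.find hex, fun h0 => ?_, fun j hj => ?_, fun j hj => ?_, ?_⟩
  · rw [h0, harm_zero] at hm
    have : 0 < 1 / θ := by positivity
    linarith
  · have h1 := not_le.1 (Nat.find_min hex hj)
    rw [lt_div_iff₀ hθ] at h1
    exact mul_nonpos_of_nonneg_of_nonpos (survival_pos hθ hk j).le (by linarith)
  · exact mul_nonneg (survival_pos hθ hk j).le
      (key j (hm.trans ((harm_strictMono hk).monotone hj)))
  · refine mul_pos (survival_pos hθ hk _) ?_
    have h1 := harm_strictMono hk (Nat.lt_succ_self (Nat.find hex))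
    have h2 := key _ hm
    have h3 := mul_lt_mul_of_pos_left h1 hθ
    simp only [Nat.succ_eq_add_one] at h3
    linarith

lemma egf_gainCoeff_pos_of_nonneg {x y : ℝ} (hx : 0 < x) (hxy : x < y)
    (h : 0 ≤ egf (gainCoeff θ k) x) : 0 < egf (gainCoeff θ k) y := by
  obtain ⟨m, hm, h1, h2, -⟩ := exists_gainCoeff_sign_change hθ hk
  exact egf_pos_of_nonneg (abs_gainCoeff_le hθ hk) hm (by simp [gainCoeff]) h1 h2 hx hxy h

lemma existsUnique_egf_gainCoeff_eq_zero : ∃! x, 0 < x ∧ egf (gainCoeff θ k) x = 0 := by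
  obtain ⟨m, hm, h1, h2, h3⟩ := exists_gainCoeff_sign_change hθ hk
  obtain ⟨y, hy, hFy⟩ := exists_egf_pos (abs_gainCoeff_le hθ hk) h1 h2 h3
  have h0 : egf (gainCoeff θ k) 0 = -1 := by simp [egf_zero, gainCoeff]
  obtain ⟨x, hx, hFx⟩ := intermediate_value_Icc hy.le
    (continuous_egf (abs_gainCoeff_le hθ hk)).continuousOn
    (show (0 : ℝ) ∈ Set.Icc _ _ from ⟨by rw [h0]; norm_num, hFy.le⟩)
  have hx0 : 0 < x := hx.1.lt_of_ne fun h => by rw [← h, h0] at hFx; norm_num at hFx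
  refine ⟨x, ⟨hx0, hFx⟩, fun z hz => ?_⟩
  rcases lt_trichotomy z x with h | h | h
  · exact absurd hFx (egf_gainCoeff_pos_of_nonneg hθ hk hz.1 h hz.2.ge).ne'
  · exact h
  · exact absurd hz.2 (egf_gainCoeff_pos_of_nonneg hθ hk hx0 h hFx.ge).ne'

/-- Chebyshev's sum inequality for the increasing sequences `harm k j` and
`survival θ (k + 1) j / survival θ k j`. -/
lemma chebyshev_egf {x : ℝ} (hx : 0 ≤ x) :
    egf (fun j => survival θ k j * harm k j) x * egf (survival θ (k + 1)) x
      ≤ egf (survival θ k) x * (egf (fun j => survival θ (k + 1) j * harm (k + 1) j) x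
          + 1 / k * egf (survival θ (k + 1)) x) := by
  classical
  have hk0 : (0 : ℝ) < k := by exact_mod_cast hk
  have hk1 : 1 ≤ k + 1 := by omega
  have sM := (summable_egf (abs_survival_le hθ hk) x).hasSum
  have sV := (summable_egf (abs_survival_mul_harm_le hθ hk) x).hasSum
  have sM' := (summable_egf (abs_survival_le hθ hk1) x).hasSum
  have sV' := (summable_egf (abs_survival_mul_harm_le hθ hk1) x).hasSum
  have hM : 0 < egf (survival θ k) x := egf_survival_pos hθ hk hx
  change HasSum _ (egf (survival θ k) x) at sM
  change HasSum _ (egf (fun j => survival θ k j * harm k j) x) at sV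
  change HasSum _ (egf (survival θ (k + 1)) x) at sM'
  change HasSum _ (egf (fun j => survival θ (k + 1) j * harm (k + 1) j) x) at sV'
  set M := egf (survival θ k) x
  set V := egf (fun j => survival θ k j * harm k j) x
  set M' := egf (survival θ (k + 1)) x
  set V' := egf (fun j => survival θ (k + 1) j * harm (k + 1) j) x
  -- `r` is the mean of `harm k`, and `c` the ratio of the two weights
  set r := V / M with hr
  set c : ℕ → ℝ := fun j => (θ + k) / k * (((k : ℝ) + j) / (θ + k + j)) with hc
  have hcs : ∀ j, survival θ (k + 1) j = survival θ k j * c j := fun j => by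
    have h1 := survival_succ θ k j
    rw [survival_succ_left] at h1
    rw [hc]
    field_simp at h1 ⊢
    linarith
  have hcmono : Monotone c := fun i j hij => by
    have hij' : (i : ℝ) ≤ j := by exact_mod_cast hij
    simp only [hc]
    refine mul_le_mul_of_nonneg_left ?_ (by positivity)
    rw [div_le_div_iff₀ (by positivity) (by positivity)]
    nlinarith
  have hex := exists_le_harm hk r
  set m := Nat.find hex
  have e0 : V - r * M = 0 := by rw [hr, div_mul_cancel₀ _ hM.ne', sub_self]
  have hle : c m * (V - r * M) ≤ (V' + 1 / k * M') - r * M' := by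
    refine hasSum_le (fun j => ?_) ((sV.sub (sM.mul_left r)).mul_left (c m))
      ((sV'.add (sM'.mul_left (1 / (k : ℝ)))).sub (sM'.mul_left r))
    have hw : 0 ≤ survival θ k j * (x ^ j / (j.factorial : ℝ)) := by
      have := survival_pos hθ hk j
      positivity
    have hcj : 0 ≤ c j := by positivity
    have h1 : c m * (harm k j - r) ≤ c j * (harm k j - r) := by
      rcases lt_or_ge j m with hjm | hjm
      · have := not_le.1 (Nat.find_min hex hjm)
        exact mul_le_mul_of_nonpos_right (hcmono hjm.le) (by linarith)
      · have : r ≤ harm k j := (Nat.find_spec hex).trans ((harm_strictMono hk).monotone hjm)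
        exact mul_le_mul_of_nonneg_right (hcmono hjm) (by linarith)
    have h2 : c j * (harm k j - r) ≤ c j * (harm (k + 1) j + 1 / k - r) := by
      have h3 := harm_succ_left k j
      have h4 := harm_strictMono hk (Nat.lt_succ_self j)
      simp only [Nat.succ_eq_add_one] at h4
      exact mul_le_mul_of_nonneg_left (by linarith) hcj
    have h5 := mul_le_mul_of_nonneg_left (h1.trans h2) hw
    rw [hcs j]
    calc _ = survival θ k j * (x ^ j / (j.factorial : ℝ)) * (c m * (harm k j - r)) := by ring
      _ ≤ _ := h5
      _ = _ := by ring
  rw [e0, mul_zero] at hle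
  have h6 : r * M' ≤ V' + 1 / k * M' := by linarith
  calc V * M' = M * (r * M') := by rw [hr]; field_simp
    _ ≤ _ := mul_le_mul_of_nonneg_left h6 hM.le

/-- A contiguity relation between `M(k, θ + k, x)` and its two successors. -/
lemma egf_survival_contiguous (x : ℝ) :
    egf (survival θ k) x = egf (survival θ (k + 1)) x
      - 1 / (θ + k) * (x * egf (survival θ (k + 1)) x)
      + (k + 1) / ((θ + k) * (θ + k + 1)) * (x * egf (survival θ (k + 2)) x) := by
  have hk0 : (0 : ℝ) < k := by exact_mod_cast hk
  have s0 := (summable_egf (abs_survival_le hθ hk) x).hasSum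
  have s1 := (summable_egf (abs_survival_le hθ (k := k + 1) (by omega)) x).hasSum
  have s2 := (summable_egf (abs_survival_le hθ (k := k + 2) (by omega)) x).hasSum
  refine s0.unique ((((s1.sub ((hasSum_egf_mul s1).mul_left (1 / (θ + k)))).add
    ((hasSum_egf_mul s2).mul_left ((k + 1) / ((θ + k) * (θ + k + 1)))))).congr_fun fun j => ?_)
  rcases j with _ | j
  · simp
  have e1 := survival_succ θ (k + 1) j
  have e2 := survival_succ_left θ (k + 1) j
  rw [survival_succ_left θ k j]
  rw [e2] at e1
  rw [e2]
  push_cast at e1 ⊢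
  have e3 : survival θ (k + 1 + 1) j
      = (θ + k + 1) / (k + 1) * (survival θ (k + 1) j * ((k + 1 + j) / (θ + k + 1 + j))) := by
    have : θ + (k + 1 : ℝ) = θ + k + 1 := by ring
    rw [this] at e1
    rw [← e1]; field_simp
  rw [show k + 2 = k + 1 + 1 from rfl, e3]
  field_simp
  ring

/-- The derivative of `egf_survival_contiguous` in the first parameter. -/
lemma egf_survival_mul_harm_contiguous (x : ℝ) :
    egf (fun j => survival θ k j * harm k j) x
      = egf (fun j => survival θ (k + 1) j * harm (k + 1) j) x
        - 1 / (θ + k) * (x * egf (fun j => survival θ (k + 1) j * harm (k + 1) j) x)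
        + (k + 1) / ((θ + k) * (θ + k + 1)) *
          (x * (egf (fun j => survival θ (k + 2) j * harm (k + 2) j) x
            + 1 / (k + 1) * egf (survival θ (k + 2)) x)) := by
  have hk0 : (0 : ℝ) < k := by exact_mod_cast hk
  have s0 := (summable_egf (abs_survival_mul_harm_le hθ hk) x).hasSum
  have s1 := (summable_egf (abs_survival_mul_harm_le hθ (k := k + 1) (by omega)) x).hasSum
  have s2 := (summable_egf (abs_survival_mul_harm_le hθ (k := k + 2) (by omega)) x).hasSum
  have s3 := (summable_egf (abs_survival_le hθ (k := k + 2) (by omega)) x).hasSum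
  rw [mul_add x, ← mul_assoc x, mul_comm x (1 / _), mul_assoc _ x]
  refine s0.unique ((((s1.sub ((hasSum_egf_mul s1).mul_left (1 / (θ + k)))).add
    (((hasSum_egf_mul s2).add ((hasSum_egf_mul s3).mul_left (1 / ((k : ℝ) + 1)))).mul_left
      ((k + 1) / ((θ + k) * (θ + k + 1)))))).congr_fun fun j => ?_)
  rcases j with _ | j
  · simp
  have e1 := survival_succ θ (k + 1) j
  have e2 := survival_succ_left θ (k + 1) j
  have h1 := harm_succ (k + 1) j
  have h2 := harm_succ_left (k + 1) j
  rw [survival_succ_left θ k j, harm_succ_left k j]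
  rw [e2] at e1
  rw [e2, h2]
  rw [h2] at h1
  push_cast at e1 h1 ⊢
  have e3 : survival θ (k + 1 + 1) j
      = (θ + k + 1) / (k + 1) * (survival θ (k + 1) j * ((k + 1 + j) / (θ + k + 1 + j))) := by
    have : θ + (k + 1 : ℝ) = θ + k + 1 := by ring
    rw [this] at e1
    rw [← e1]; field_simp
  have h3 : harm (k + 1 + 1) j = harm (k + 1) j + 1 / (k + 1 + j) - 1 / (k + 1) := by linarith
  rw [show k + 2 = k + 1 + 1 from rfl, e3, h3]
  field_simp
  ring

/-- The ratio `D_a M / M` decreases when both parameters increase by one. With `Δ k` the decrease,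
the contiguity relations say that `Δ k` is a nonnegative multiple of `1 / (k + 1) - Δ (k + 1)`, which
is nonnegative by Chebyshev's inequality. -/
lemma egf_ratio_antitone {x : ℝ} (hx : 0 ≤ x) :
    egf (fun j => survival θ (k + 1) j * harm (k + 1) j) x * egf (survival θ k) x
      ≤ egf (fun j => survival θ k j * harm k j) x * egf (survival θ (k + 1)) x := by
  have hk0 : (0 : ℝ) < k := by exact_mod_cast hk
  have h1 := chebyshev_egf hθ (k := k + 1) (by omega) hx
  rw [egf_survival_contiguous hθ hk, egf_survival_mul_harm_contiguous hθ hk]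
  simp only [Nat.add_assoc, Nat.reduceAdd, Nat.cast_add, Nat.cast_one] at h1
  have hα : 0 ≤ (k + 1) / ((θ + k) * (θ + k + 1)) * x := by positivity
  have := mul_le_mul_of_nonneg_left h1 hα
  linarith

end

/-! ### Kummer's function as a generating function -/

lemma ascPochhammer_eval_eq_prod_range (j : ℕ) (a : ℝ) :
    (ascPochhammer ℝ j).eval a = ∏ i ∈ Finset.range j, (a + i) := by
  induction j with
  | zero => simp
  | succ j ih => rw [ascPochhammer_succ_eval, ih, Finset.prod_range_succ]

lemma hasDerivAt_ascPochhammer_eval (j : ℕ) {a : ℝ} (ha : 0 < a) :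
    HasDerivAt (fun a => (ascPochhammer ℝ j).eval a)
      ((ascPochhammer ℝ j).eval a * ∑ i ∈ Finset.range j, 1 / (a + i)) a := by
  induction j with
  | zero => simpa using hasDerivAt_const a (1 : ℝ)
  | succ j ih =>
    have h1 := ih.mul ((hasDerivAt_id a).add_const (j : ℝ))
    refine (h1.congr_deriv ?_).congr_of_eventuallyEq (Filter.Eventually.of_forall fun b => ?_)
    · rw [ascPochhammer_succ_eval, Finset.sum_range_succ]
      simp only [id]
      field_simp
    · simp [ascPochhammer_succ_eval]

lemma ascPochhammer_eval_div (θ : ℝ) (k j : ℕ) :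
    (ascPochhammer ℝ j).eval (k : ℝ) / (ascPochhammer ℝ j).eval (θ + k) = survival θ k j := by
  rw [ascPochhammer_eval_eq_prod_range, ascPochhammer_eval_eq_prod_range, survival,
    Finset.prod_div_distrib]

lemma kummer_eq_egf (θ : ℝ) (k : ℕ) (x : ℝ) : kummer k (θ + k) x = egf (survival θ k) x := by
  simp only [kummer, egf, ascPochhammer_eval_div]

section
variable {θ : ℝ} (hθ : 0 < θ) {k : ℕ} (hk : 1 ≤ k)
include hθ hk

/-- The coefficients of the parameter derivative of Kummer's function grow at most
exponentially, locally uniformly in the parameter. -/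
lemma abs_deriv_ascPochhammer_div_le {a : ℝ} (ha : a ∈ Set.Ioo ((k : ℝ) - 1 / 2) (k + 1)) (j : ℕ) :
    |(ascPochhammer ℝ j).eval a * (∑ i ∈ Finset.range j, 1 / (a + i))
      / (ascPochhammer ℝ j).eval (θ + k)| ≤ 2 * 4 ^ j := by
  have hk' : (1 : ℝ) ≤ k := by exact_mod_cast hk
  have ha0 : 1 / 2 < a := by linarith [ha.1]
  have hc : 0 < (ascPochhammer ℝ j).eval (θ + k) := by
    rw [ascPochhammer_eval_eq_prod_range]; exact Finset.prod_pos fun i _ => by positivity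
  have hp : 0 ≤ (ascPochhammer ℝ j).eval a := by
    rw [ascPochhammer_eval_eq_prod_range]; exact Finset.prod_nonneg fun i _ => by positivity
  have hs : 0 ≤ ∑ i ∈ Finset.range j, 1 / (a + i) := Finset.sum_nonneg fun i _ => by positivity
  rw [abs_of_nonneg (by positivity), div_le_iff₀ hc]
  have h1 : ∑ i ∈ Finset.range j, 1 / (a + i) ≤ 2 * j := by
    calc _ ≤ ∑ _i ∈ Finset.range j, (2 : ℝ) := by
          refine Finset.sum_le_sum fun i _ => ?_
          have h2 : (0 : ℝ) ≤ i := i.cast_nonneg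
          rw [div_le_iff₀ (by linarith)]; linarith
      _ = _ := by simp [mul_comm]
  have h2 : (ascPochhammer ℝ j).eval a ≤ (j + 1) * (ascPochhammer ℝ j).eval (θ + k) := by
    have e1 : (ascPochhammer ℝ j).eval a ≤ ∏ i ∈ Finset.range j, ((k : ℝ) + 1 + i) := by
      rw [ascPochhammer_eval_eq_prod_range]
      exact Finset.prod_le_prod (fun i _ => by positivity) fun i _ => by linarith [ha.2]
    have e2 : (∏ i ∈ Finset.range j, ((k : ℝ) + 1 + i)) * k
        = (∏ i ∈ Finset.range j, ((k : ℝ) + i)) * (k + j) := by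
      rw [← Finset.prod_range_succ, Finset.prod_range_succ']
      push_cast
      rw [add_zero]
      congr 1
      exact Finset.prod_congr rfl fun i _ => by ring
    have e3 : ∏ i ∈ Finset.range j, ((k : ℝ) + i) ≤ (ascPochhammer ℝ j).eval (θ + k) := by
      rw [ascPochhammer_eval_eq_prod_range]
      exact Finset.prod_le_prod (fun i _ => by positivity) fun i _ => by linarith
    have e4 : (0 : ℝ) ≤ j := j.cast_nonneg
    have e5 : (0 : ℝ) ≤ ∏ i ∈ Finset.range j, ((k : ℝ) + i) :=
      Finset.prod_nonneg fun i _ => by positivity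
    have e6 : ∏ i ∈ Finset.range j, ((k : ℝ) + 1 + i)
        ≤ (j + 1) * ∏ i ∈ Finset.range j, ((k : ℝ) + i) := by
      have h3 : (k : ℝ) + j ≤ (j + 1) * k := by nlinarith
      have h4 := mul_le_mul_of_nonneg_left h3 e5
      refine le_of_mul_le_mul_right ?_ (show (0 : ℝ) < k by linarith)
      rw [e2]; linarith
    calc _ ≤ _ := e1.trans e6
      _ ≤ _ := by gcongr
  have h3 := cast_le_two_pow j
  have h4 : (j : ℝ) + 1 ≤ 2 ^ j := by exact_mod_cast j.lt_two_pow_self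
  calc (ascPochhammer ℝ j).eval a * ∑ i ∈ Finset.range j, 1 / (a + i)
      ≤ ((j + 1) * (ascPochhammer ℝ j).eval (θ + k)) * (2 * j) :=
        mul_le_mul h2 h1 hs (by positivity)
    _ ≤ (2 ^ j * (ascPochhammer ℝ j).eval (θ + k)) * (2 * 2 ^ j) := by gcongr
    _ = 2 * (2 * 2) ^ j * (ascPochhammer ℝ j).eval (θ + k) := by rw [mul_pow]; ring
    _ = _ := by norm_num

lemma deriv_kummer_eq_egf (x : ℝ) :
    deriv (fun a : ℝ => kummer a (θ + k) x) (k : ℝ)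
      = egf (fun j => survival θ k j * harm k j) x := by
  have hk' : (1 : ℝ) ≤ k := by exact_mod_cast hk
  have hmem : (k : ℝ) ∈ Set.Ioo ((k : ℝ) - 1 / 2) (k + 1) := ⟨by linarith, by linarith⟩
  have h := hasDerivAt_tsum_of_isPreconnected
    (g := fun (j : ℕ) (a : ℝ) =>
      (ascPochhammer ℝ j).eval a / (ascPochhammer ℝ j).eval (θ + k) * (x ^ j / (j.factorial : ℝ)))
    (g' := fun (j : ℕ) (a : ℝ) => (ascPochhammer ℝ j).eval a
      * (∑ i ∈ Finset.range j, 1 / (a + i)) / (ascPochhammer ℝ j).eval (θ + k)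
        * (x ^ j / (j.factorial : ℝ)))
    ((Real.summable_pow_div_factorial (4 * |x|)).mul_left 2) isOpen_Ioo isPreconnected_Ioo
    (fun j a ha => ((hasDerivAt_ascPochhammer_eval j (by linarith [ha.1])).div_const _).mul_const _)
    (fun j a ha => ?_) hmem ?_ hmem
  · refine h.deriv.trans (tsum_congr fun j => ?_)
    rw [mul_div_right_comm, ascPochhammer_eval_div]
    rfl
  · rw [Real.norm_eq_abs, abs_mul, abs_div (x ^ j), abs_pow, Nat.abs_cast, mul_pow]
    calc _ ≤ 2 * 4 ^ j * (|x| ^ j / (j.factorial : ℝ)) := by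
          gcongr; exact abs_deriv_ascPochhammer_div_le hθ hk ha j
      _ = _ := by ring
  · simp only [ascPochhammer_eval_div]
    exact summable_egf (abs_survival_le hθ hk) x

lemma isCriticalRoot_iff (x : ℝ) : IsCriticalRoot θ k x ↔ 0 < x ∧ egf (gainCoeff θ k) x = 0 := by
  rw [IsCriticalRoot, deriv_kummer_eq_egf hθ hk, kummer_eq_egf, egf_gainCoeff hθ hk]

lemma IsCriticalRoot.egf_nonpos {x y : ℝ} (hy : IsCriticalRoot θ k y) (hx : 0 ≤ x) (hxy : x ≤ y) :
    egf (gainCoeff θ k) x ≤ 0 := by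
  rw [isCriticalRoot_iff hθ hk] at hy
  rcases hxy.eq_or_lt with rfl | hlt
  · exact hy.2.le
  rcases hx.eq_or_lt with rfl | hx
  · simp [egf_zero, gainCoeff]
  · by_contra! h
    exact (egf_gainCoeff_pos_of_nonneg hθ hk hx hlt h.le).ne' hy.2

lemma IsCriticalRoot.egf_nonneg {x y : ℝ} (hy : IsCriticalRoot θ k y) (hxy : y ≤ x) :
    0 ≤ egf (gainCoeff θ k) x := by
  rw [isCriticalRoot_iff hθ hk] at hy
  rcases hxy.eq_or_lt with rfl | hlt
  · exact hy.2.ge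
  · exact (egf_gainCoeff_pos_of_nonneg hθ hk hy.1 hlt hy.2.ge).le

/-- The critical roots increase with `k`. -/
lemma IsCriticalRoot.le_succ {x y : ℝ} (hx : IsCriticalRoot θ k x)
    (hy : IsCriticalRoot θ (k + 1) y) : x ≤ y := by
  have hk1 : 1 ≤ k + 1 := by omega
  rw [isCriticalRoot_iff hθ hk] at hx
  rw [isCriticalRoot_iff hθ hk1] at hy
  by_contra! hlt
  have hM := egf_survival_pos hθ hk hy.1.le
  have hM' := egf_survival_pos hθ hk1 hy.1.le
  have h1 := egf_ratio_antitone hθ hk hy.1.le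
  have h2 := hy.2
  rw [egf_gainCoeff hθ hk1] at h2
  have h3 : 0 ≤ egf (gainCoeff θ k) y := by
    rw [egf_gainCoeff hθ hk]
    refine nonneg_of_mul_nonneg_left ?_ hM'
    have h4 := mul_le_mul_of_nonneg_left h1 hθ.le
    have h5 : egf (survival θ k) y * (θ * egf (fun j => survival θ (k + 1) j * harm (k + 1) j) y
      - egf (survival θ (k + 1)) y) = 0 := by rw [h2, mul_zero]
    linarith
  exact (egf_gainCoeff_pos_of_nonneg hθ hk hy.1 hlt h3).ne' hx.2

end

/-! ### Arrival times and the natural filtration -/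

section Paths
variable {Ω : Type*} {N : unitInterval → Ω → ℕ} {X : ℕ → Ω → Bool} {ω : Ω}

lemma arrivalTime_le_of_le {k : ℕ} {t : unitInterval} (h : k ≤ N t ω) : arrivalTime N k ω ≤ t :=
  sInf_le h

lemma arrivalTime_eq_one (hmono : Monotone fun t => N t ω) {k : ℕ} (h : ¬ k ≤ N 1 ω) :
    arrivalTime N k ω = 1 := by
  have : {t | k ≤ N t ω} = ∅ := by
    ext t
    simp only [Set.mem_ofPred_eq, Set.mem_empty_iff_false, iff_false]
    exact fun ht => h (ht.trans (hmono unitInterval.le_one'))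
  rw [arrivalTime, this, sInf_empty]; rfl

/-- By right continuity, the `k`-th arrival has happened at its own epoch. -/
lemma le_apply_arrivalTime
    (hcont : ∀ t, ContinuousWithinAt (fun s => N s ω) (Set.Ici t) t) {k : ℕ} (h : k ≤ N 1 ω) :
    k ≤ N (arrivalTime N k ω) ω := by
  set T := arrivalTime N k ω with hT
  have hne : {t | k ≤ N t ω}.Nonempty := ⟨1, h⟩
  have hmem : T ∈ closure {t | k ≤ N t ω} := sInf_mem_closure hne
  have hsub : {t | k ≤ N t ω} ⊆ Set.Ici T := fun t ht => sInf_le ht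
  have hev := ((hcont T).mono hsub).eventually (IsOpen.mem_nhds (isOpen_discrete {N T ω}) rfl)
  have : (nhdsWithin T {t | k ≤ N t ω}).NeBot := mem_closure_iff_nhdsWithin_neBot.1 hmem
  obtain ⟨s, hs1, hs2⟩ := (hev.and self_mem_nhdsWithin).exists
  have hs1' : N s ω = N T ω := hs1
  exact hs1' ▸ hs2

lemma arrivalTime_le_iff (hmono : Monotone fun t => N t ω)
    (hcont : ∀ t, ContinuousWithinAt (fun s => N s ω) (Set.Ici t) t) {k : ℕ} (h : k ≤ N 1 ω)
    {t : unitInterval} : arrivalTime N k ω ≤ t ↔ k ≤ N t ω :=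
  ⟨fun ht => (le_apply_arrivalTime hcont h).trans (hmono ht), arrivalTime_le_of_le⟩

lemma arrivalTime_le_iff_of_lt_one (hmono : Monotone fun t => N t ω)
    (hcont : ∀ t, ContinuousWithinAt (fun s => N s ω) (Set.Ici t) t) {k : ℕ}
    {t : unitInterval} (ht : t < 1) : arrivalTime N k ω ≤ t ↔ k ≤ N t ω := by
  by_cases h : k ≤ N 1 ω
  · exact arrivalTime_le_iff hmono hcont h
  · rw [arrivalTime_eq_one hmono h]
    exact ⟨fun h1 => absurd h1 (not_le.2 ht),
      fun h1 => absurd (h1.trans (hmono unitInterval.le_one')) h⟩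

lemma arrivalTime_mono {j k : ℕ} (hjk : j ≤ k) : arrivalTime N j ω ≤ arrivalTime N k ω :=
  sInf_le_sInf fun _ ht => hjk.trans ht

end Paths

section History
variable {Ω : Type*} {N : unitInterval → Ω → ℕ} {X : ℕ → Ω → Bool}

lemma measurable_history {s t : unitInterval} (h : s ≤ t) :
    Measurable[history N X t] (fun ω => ((N s ω,
      fun n : ℕ => decide (n + 1 ≤ N s ω) && X (n + 1) ω) : ℕ × (ℕ → Bool))) :=
  Measurable.of_comap_le (le_iSup₂_of_le (f := fun r (_ : r ≤ t) => MeasurableSpace.comap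
    (fun ω => ((N r ω, fun n : ℕ => decide (n + 1 ≤ N r ω) && X (n + 1) ω) : ℕ × (ℕ → Bool)))
      inferInstance) s h le_rfl)

lemma measurable_count_history {s t : unitInterval} (h : s ≤ t) :
    Measurable[history N X t] (N s) :=
  measurable_fst.comp (measurable_history (X := X) h)

lemma measurableSet_history_success {s t : unitInterval} (h : s ≤ t) {k : ℕ} (hk : 1 ≤ k) :
    MeasurableSet[history N X t] {ω | k ≤ N s ω ∧ X k ω = true} := by
  obtain ⟨n, rfl⟩ := Nat.exists_eq_add_of_le' hk
  have h1 : Measurable[history N X t] fun ω => decide (n + 1 ≤ N s ω) && X (n + 1) ω :=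
    ((measurable_pi_apply n).comp measurable_snd).comp (measurable_history h)
  have h2 := h1 (measurableSet_singleton true)
  convert h2 using 1
  ext ω
  simp

end History

section Threshold
variable {Ω : Type*} {Λ : unitInterval → ℝ} {N : unitInterval → Ω → ℕ} {X : ℕ → Ω → Bool}
  {γ : ℕ → ℝ} {ω : Ω}

/-- The infimum in the definition of the threshold rule is over a finite set, so it is attained
unless the set is empty. -/
lemma thresholdRule_mem_or_eq_one :
    (∃ k, 1 ≤ k ∧ k ≤ N 1 ω ∧ thresholdRule Λ γ N X ω = arrivalTime N k ω ∧ X k ω = true ∧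
      Λ 1 - Λ (arrivalTime N k ω) ≤ γ k) ∨ thresholdRule Λ γ N X ω = 1 := by
  set S := {t | ∃ k, 1 ≤ k ∧ k ≤ N 1 ω ∧ t = arrivalTime N k ω ∧ X k ω = true ∧
    Λ 1 - Λ t ≤ γ k} with hS
  rcases S.eq_empty_or_nonempty with h | h
  · right
    rw [thresholdRule, ← hS, h, sInf_empty]; rfl
  · left
    have hfin : S.Finite := by
      refine ((Finset.range (N 1 ω + 1)).finite_toSet.image fun k => arrivalTime N k ω).subset ?_
      rintro t ⟨k, -, hk, rfl, -⟩
      exact ⟨k, by simpa using Nat.lt_succ_of_le hk, rfl⟩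
    obtain ⟨k, h1, h2, h3, h4, h5⟩ : sInf S ∈ S := h.csInf_mem hfin
    exact ⟨k, h1, h2, h3, h4, h3 ▸ h5⟩

lemma thresholdRule_le {k : ℕ} (h1 : 1 ≤ k) (h2 : k ≤ N 1 ω) (h3 : X k ω = true)
    (h4 : Λ 1 - Λ (arrivalTime N k ω) ≤ γ k) : thresholdRule Λ γ N X ω ≤ arrivalTime N k ω :=
  sInf_le ⟨k, h1, h2, rfl, h3, h4⟩

end Threshold

section Model
variable {Ω : Type*} [mΩ : MeasurableSpace Ω] {P : Measure Ω} {θ : ℝ} {Λ : unitInterval → ℝ}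
  {N : unitInterval → Ω → ℕ} {X : ℕ → Ω → Bool}

lemma history_le (hN : ∀ t, Measurable (N t)) (hX : ∀ k, 1 ≤ k → Measurable (X k))
    (t : unitInterval) : history N X t ≤ mΩ :=
  iSup₂_le fun s _ => Measurable.comap_le <| (hN s).prodMk <| measurable_pi_lambda _ fun n => by
    have h1 : Measurable fun ω => decide (n + 1 ≤ N s ω) :=
      (measurable_of_countable fun m : ℕ => decide (n + 1 ≤ m)).comp (hN s)
    exact (measurable_of_countable fun p : Bool × Bool => p.1 && p.2).comp
      (h1.prodMk (hX (n + 1) (by omega)))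

/-- The epoch of the `k`-th arrival, stopped at time `t`, is known at time `t`. -/
lemma IsPoissonProcess.measurable_min_arrivalTime (h : IsPoissonProcess P Λ N) (k : ℕ)
    (t : unitInterval) : Measurable[history N X t] fun ω => min (arrivalTime N k ω) t := by
  refine measurable_of_Iic fun s => ?_
  by_cases hts : t ≤ s
  · convert @MeasurableSet.univ _ (history N X t)
    ext ω
    simp [hts]
  · have hst : s < t := not_le.1 hts
    have : (fun ω => min (arrivalTime N k ω) t) ⁻¹' Set.Iic s = N s ⁻¹' Set.Ici k := by
      ext ω
      simp only [Set.mem_preimage, Set.mem_Iic, min_le_iff, hts, or_false, Set.mem_Ici]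
      exact arrivalTime_le_iff_of_lt_one (h.mono ω) (h.rightCont ω)
        (hst.trans_le unitInterval.le_one')
    rw [this]
    exact measurable_count_history hst.le trivial

lemma IsPoissonProcess.measurable_arrivalTime (h : IsPoissonProcess P Λ N) (k : ℕ) :
    Measurable (arrivalTime N k) := by
  have h1 := (h.measurable_min_arrivalTime (X := fun _ _ => true) k 1).mono
    (history_le h.measurable (fun _ _ => measurable_const) 1) le_rfl
  convert h1 using 2 with ω
  exact (min_eq_left unitInterval.le_one').symm

lemma IsStrategy.measurable {τ : Ω → unitInterval} (hN : ∀ t, Measurable (N t))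
    (hX : ∀ k, 1 ≤ k → Measurable (X k)) (hτ : IsStrategy N X τ) : Measurable τ :=
  measurable_of_Iic fun t => history_le hN hX t _ (hτ.adapted t)

lemma IsPoissonProcess.isStrategy_thresholdRule (h : IsPoissonProcess P Λ N)
    (hΛ : Continuous Λ) (γ : ℕ → ℝ) : IsStrategy N X (thresholdRule Λ γ N X) where
  values ω := by
    rcases thresholdRule_mem_or_eq_one (Λ := Λ) (γ := γ) (N := N) (X := X) (ω := ω) with
      ⟨k, h1, h2, h3, -⟩ | h1
    · exact Or.inr ⟨k, h1, h2, h3⟩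
    · exact Or.inl h1
  adapted t := by
    rcases eq_or_lt_of_le (unitInterval.le_one' (t := t)) with rfl | ht
    · convert @MeasurableSet.univ _ (history N X 1)
      ext ω
      simpa using (unitInterval.le_one' (t := thresholdRule Λ γ N X ω))
    have : {ω | thresholdRule Λ γ N X ω ≤ t} = ⋃ k, ⋃ (_ : 1 ≤ k),
        {ω | k ≤ N t ω ∧ X k ω = true} ∩
          (fun ω => min (arrivalTime N k ω) t) ⁻¹' {u | Λ 1 - Λ u ≤ γ k} := by
      ext ω
      have hmin : ∀ k, k ≤ N t ω → min (arrivalTime N k ω) t = arrivalTime N k ω :=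
        fun k hk => min_eq_left (arrivalTime_le_of_le hk)
      simp only [Set.mem_ofPred_eq, Set.mem_iUnion, Set.mem_inter_iff, Set.mem_preimage,
        exists_prop]
      constructor
      · intro hle
        rcases thresholdRule_mem_or_eq_one (Λ := Λ) (γ := γ) (N := N) (X := X) (ω := ω) with
          ⟨k, h1, h2, h3, h4, h5⟩ | h1
        · have hk : k ≤ N t ω :=
            (arrivalTime_le_iff_of_lt_one (h.mono ω) (h.rightCont ω) ht).1 (h3 ▸ hle)
          exact ⟨k, h1, ⟨hk, h4⟩, by rwa [hmin k hk]⟩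
        · rw [h1] at hle
          exact absurd hle (not_le.2 ht)
      · rintro ⟨k, h1, ⟨h2, h3⟩, h4⟩
        rw [hmin k h2] at h4
        exact (thresholdRule_le h1 (h2.trans (h.mono ω unitInterval.le_one')) h3 h4).trans
          (arrivalTime_le_of_le h2)
    rw [this]
    refine MeasurableSet.iUnion fun k => MeasurableSet.iUnion fun hk => ?_
    refine (measurableSet_history_success le_rfl hk).inter
      (h.measurable_min_arrivalTime k t ?_)
    exact (isClosed_le (by fun_prop) continuous_const).measurableSet

end Model

/-! ### Independence of the past and the future -/

section Indep
variable {Ω : Type*}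

lemma isPiSystem_inter (m₁ m₂ : MeasurableSpace Ω) :
    IsPiSystem {s | ∃ a b, MeasurableSet[m₁] a ∧ MeasurableSet[m₂] b ∧ s = a ∩ b} := by
  rintro _ ⟨a, b, ha, hb, rfl⟩ _ ⟨a', b', ha', hb', rfl⟩ -
  exact ⟨a ∩ a', b ∩ b', ha.inter ha', hb.inter hb', Set.inter_inter_inter_comm ..⟩

lemma sup_eq_generateFrom_inter (m₁ m₂ : MeasurableSpace Ω) :
    m₁ ⊔ m₂ = MeasurableSpace.generateFrom
      {s | ∃ a b, MeasurableSet[m₁] a ∧ MeasurableSet[m₂] b ∧ s = a ∩ b} := by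
  refine le_antisymm (sup_le ?_ ?_) (MeasurableSpace.generateFrom_le ?_)
  · exact fun s hs => MeasurableSpace.measurableSet_generateFrom
      ⟨s, Set.univ, hs, MeasurableSet.univ, (Set.inter_univ s).symm⟩
  · exact fun s hs => MeasurableSpace.measurableSet_generateFrom
      ⟨Set.univ, s, MeasurableSet.univ, hs, (Set.univ_inter s).symm⟩
  · rintro _ ⟨a, b, ha, hb, rfl⟩
    exact ((le_sup_left : m₁ ≤ m₁ ⊔ m₂) a ha).inter ((le_sup_right : m₂ ≤ m₁ ⊔ m₂) b hb)

/-- Four σ-algebras that are independent as two independent pairs can be regrouped. -/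
lemma Indep.sup_sup_comm [mΩ : MeasurableSpace Ω] {P : Measure Ω} [IsProbabilityMeasure P]
    {m₁ m₂ m₃ m₄ : MeasurableSpace Ω}
    (h₁ : m₁ ≤ mΩ) (h₂ : m₂ ≤ mΩ) (h₃ : m₃ ≤ mΩ) (h₄ : m₄ ≤ mΩ)
    (h₁₂ : Indep m₁ m₂ P) (h₃₄ : Indep m₃ m₄ P) (h : Indep (m₁ ⊔ m₂) (m₃ ⊔ m₄) P) :
    Indep (m₁ ⊔ m₃) (m₂ ⊔ m₄) P := by
  refine IndepSets.indep (sup_le h₁ h₃) (sup_le h₂ h₄) (isPiSystem_inter m₁ m₃)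
    (isPiSystem_inter m₂ m₄) (sup_eq_generateFrom_inter ..) (sup_eq_generateFrom_inter ..) ?_
  rw [IndepSets_iff]
  rintro _ _ ⟨a, c, ha, hc, rfl⟩ ⟨b, d, hb, hd, rfl⟩
  have l₁ : m₁ ≤ m₁ ⊔ m₂ := le_sup_left
  have l₂ : m₂ ≤ m₁ ⊔ m₂ := le_sup_right
  have l₃ : m₃ ≤ m₃ ⊔ m₄ := le_sup_left
  have l₄ : m₄ ≤ m₃ ⊔ m₄ := le_sup_right
  rw [Indep_iff] at h h₁₂ h₃₄
  rw [Set.inter_inter_inter_comm, h _ _ ((l₁ a ha).inter (l₂ b hb)) ((l₃ c hc).inter (l₄ d hd)),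
    h _ _ (l₁ a ha) (l₃ c hc), h _ _ (l₂ b hb) (l₄ d hd), h₁₂ a b ha hb, h₃₄ c d hc hd]
  ring

lemma hasSum_measureReal_iUnion [MeasurableSpace Ω] {P : Measure Ω} [IsFiniteMeasure P]
    {F : ℕ → Set Ω} (hdisj : Pairwise (Function.onFun Disjoint F))
    (hF : ∀ n, MeasurableSet (F n)) : HasSum (fun n => P.real (F n)) (P.real (⋃ n, F n)) := by
  simp only [measureReal_def]
  rw [measure_iUnion hdisj hF,
    ENNReal.tsum_toReal_eq (f := fun n => P (F n)) fun n => measure_ne_top _ _]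
  refine (ENNReal.summable_toReal ?_).hasSum
  rw [← measure_iUnion hdisj hF]
  exact measure_ne_top _ _

end Indep

section Outcomes
variable {Ω : Type*} {X : ℕ → Ω → Bool}

/-- The event that none of the trials `k + 1, …, k + n` is a success. -/
def noSuccess (X : ℕ → Ω → Bool) (k n : ℕ) : Set Ω :=
  {ω | ∀ j, k < j → j ≤ k + n → X j ω = false}

/-- The event that exactly one of the trials `k + 1, …, k + n` is a success. -/
def oneSuccess (X : ℕ → Ω → Bool) (k n : ℕ) : Set Ω :=
  {ω | ∃ i, k < i ∧ i ≤ k + n ∧ X i ω = true ∧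
    ∀ j, k < j → j ≤ k + n → j ≠ i → X j ω = false}

lemma noSuccess_zero (k : ℕ) : noSuccess X k 0 = Set.univ :=
  Set.eq_univ_of_forall fun _ j h1 h2 => by omega

lemma oneSuccess_zero (k : ℕ) : oneSuccess X k 0 = ∅ :=
  Set.eq_empty_of_forall_notMem fun _ ⟨i, h1, h2, _⟩ => by omega

lemma noSuccess_succ (k n : ℕ) :
    noSuccess X k (n + 1) = noSuccess X k n ∩ X (k + n + 1) ⁻¹' {false} := by
  ext ω
  constructor
  · exact fun h => ⟨fun j h1 h2 => h j h1 (by omega), h _ (by omega) (by omega)⟩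
  · rintro ⟨h, h'⟩ j h1 h2
    rcases (show j ≤ k + n ∨ j = k + n + 1 by omega) with h3 | rfl
    · exact h j h1 h3
    · exact h'

lemma oneSuccess_succ (k n : ℕ) :
    oneSuccess X k (n + 1) = (oneSuccess X k n ∩ X (k + n + 1) ⁻¹' {false}) ∪
      (noSuccess X k n ∩ X (k + n + 1) ⁻¹' {true}) := by
  ext ω
  constructor
  · rintro ⟨i, h1, h2, h3, h4⟩
    rcases (show i ≤ k + n ∨ i = k + n + 1 by omega) with h5 | rfl
    · exact Or.inl ⟨⟨i, h1, h5, h3, fun j h6 h7 h8 => h4 j h6 (by omega) h8⟩,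
        h4 _ (by omega) (by omega) (by omega)⟩
    · exact Or.inr ⟨fun j h6 h7 => h4 j h6 (by omega) (by omega), h3⟩
  · rintro (⟨⟨i, h1, h2, h3, h4⟩, h5⟩ | ⟨h1, h2⟩)
    · refine ⟨i, h1, by omega, h3, fun j h6 h7 h8 => ?_⟩
      rcases (show j ≤ k + n ∨ j = k + n + 1 by omega) with h9 | rfl
      · exact h4 j h6 h9 h8
      · exact h5
    · exact ⟨k + n + 1, by omega, by omega, h2, fun j h6 h7 h8 => h1 j h6 (by omega)⟩

/-- The σ-algebra generated by the outcomes of the trials `n + 1`, `n ∈ S`. -/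
abbrev trialsSigma (X : ℕ → Ω → Bool) (S : Set ℕ) : MeasurableSpace Ω :=
  ⨆ n ∈ S, MeasurableSpace.comap (X (n + 1)) inferInstance

lemma measurable_trialsSigma {S : Set ℕ} {n : ℕ} (h : n ∈ S) :
    Measurable[trialsSigma X S] (X (n + 1)) :=
  Measurable.of_comap_le
    (le_iSup₂_of_le (f := fun n (_ : n ∈ S) => MeasurableSpace.comap (X (n + 1)) inferInstance)
      n h le_rfl)

lemma measurableSet_noSuccess {S : Set ℕ} {k n : ℕ} (h : Set.Ico k (k + n) ⊆ S) :
    MeasurableSet[trialsSigma X S] (noSuccess X k n) := by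
  induction n with
  | zero => rw [noSuccess_zero]; exact MeasurableSet.univ
  | succ n ih =>
    rw [noSuccess_succ]
    exact (ih ((Set.Ico_subset_Ico_right (by omega)).trans h)).inter
      (measurable_trialsSigma (h ⟨by omega, by omega⟩) trivial)

lemma measurableSet_oneSuccess {S : Set ℕ} {k n : ℕ} (h : Set.Ico k (k + n) ⊆ S) :
    MeasurableSet[trialsSigma X S] (oneSuccess X k n) := by
  induction n with
  | zero => rw [oneSuccess_zero]; exact @MeasurableSet.empty _ (trialsSigma X S)
  | succ n ih =>
    have h' : Set.Ico k (k + n) ⊆ S := (Set.Ico_subset_Ico_right (by omega)).trans h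
    have hm := measurable_trialsSigma (X := X) (h (show k + n ∈ Set.Ico k (k + (n + 1)) from
      ⟨by omega, by omega⟩))
    rw [oneSuccess_succ]
    exact ((ih h').inter (hm trivial)).union ((measurableSet_noSuccess h').inter (hm trivial))

end Outcomes

section Model
variable {Ω : Type*} [mΩ : MeasurableSpace Ω] {P : Measure Ω} [IsProbabilityMeasure P]
  {θ : ℝ} {Λ : unitInterval → ℝ} {N : unitInterval → Ω → ℕ} {X : ℕ → Ω → Bool}

omit [IsProbabilityMeasure P] in
lemma IsModel.trialsSigma_le (h : IsModel P θ Λ N X) (S : Set ℕ) : trialsSigma X S ≤ mΩ :=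
  iSup₂_le fun n _ => (h.measurable (n + 1) (by omega)).comap_le

omit [IsProbabilityMeasure P] in
lemma IsModel.indep_trialsSigma (h : IsModel P θ Λ N X) {S T : Set ℕ} (hST : Disjoint S T) :
    Indep (trialsSigma X S) (trialsSigma X T) P :=
  indep_iSup_of_disjoint (fun n => (h.measurable (n + 1) (by omega)).comap_le) h.indep.iIndep hST

omit [IsProbabilityMeasure P] in
lemma IsModel.measureReal_success (h : IsModel P θ Λ N X) (hθ : 0 < θ) (n : ℕ) :
    P.real (X (n + 1) ⁻¹' {true}) = θ / (θ + n) := by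
  have h1 := h.profile (n + 1) (by omega)
  have e : θ + ((n + 1 : ℕ) : ℝ) - 1 = θ + n := by push_cast; ring
  rw [e] at h1
  change P (X (n + 1) ⁻¹' {true}) = _ at h1
  rw [measureReal_def, h1, ENNReal.toReal_ofReal (by positivity)]

lemma IsModel.measureReal_failure (h : IsModel P θ Λ N X) (hθ : 0 < θ) (n : ℕ) :
    P.real (X (n + 1) ⁻¹' {false}) = n / (θ + n) := by
  have h1 : X (n + 1) ⁻¹' {false} = (X (n + 1) ⁻¹' {true})ᶜ := by ext; simp
  rw [h1, probReal_compl_eq_one_sub (h.measurable (n + 1) (by omega) trivial),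
    h.measureReal_success hθ]
  field_simp
  ring

omit [IsProbabilityMeasure P] in
lemma IsModel.measureReal_inter_trial (h : IsModel P θ Λ N X) {k n : ℕ} {A : Set Ω}
    (hA : MeasurableSet[trialsSigma X (Set.Ico k (k + n))] A) (b : Bool) :
    P.real (A ∩ X (k + n + 1) ⁻¹' {b}) = P.real A * P.real (X (k + n + 1) ⁻¹' {b}) := by
  have h1 := h.indep_trialsSigma (S := Set.Ico k (k + n)) (T := {k + n}) (by simp)
  rw [Indep_iff] at h1
  rw [measureReal_def, h1 _ _ hA (measurable_trialsSigma (Set.mem_singleton _) trivial),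
    ENNReal.toReal_mul]
  rfl

lemma IsModel.measureReal_noSuccess (h : IsModel P θ Λ N X) (hθ : 0 < θ) (k n : ℕ) :
    P.real (noSuccess X k n) = survival θ k n := by
  induction n with
  | zero => simp [noSuccess_zero]
  | succ n ih =>
    rw [noSuccess_succ, h.measureReal_inter_trial (measurableSet_noSuccess le_rfl), ih,
      h.measureReal_failure hθ, survival_succ]
    push_cast
    rw [add_assoc]

lemma IsModel.measureReal_oneSuccess (h : IsModel P θ Λ N X) (hθ : 0 < θ) {k : ℕ} (hk : 1 ≤ k)
    (n : ℕ) : P.real (oneSuccess X k n) = survival θ k n * (θ * harm k n) := by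
  have hk0 : (0 : ℝ) < k := by exact_mod_cast hk
  induction n with
  | zero => simp [oneSuccess_zero]
  | succ n ih =>
    have hm : Measurable (X (k + n + 1)) := h.measurable _ (by omega)
    rw [oneSuccess_succ, measureReal_union
      (Disjoint.inter_left' _ (Disjoint.inter_right' _ (Disjoint.preimage _ (by simp))))
      ((h.trialsSigma_le _ _ (measurableSet_noSuccess le_rfl)).inter (hm trivial)),
      h.measureReal_inter_trial (measurableSet_noSuccess le_rfl),
      h.measureReal_inter_trial (measurableSet_oneSuccess le_rfl), ih,
      h.measureReal_failure hθ, h.measureReal_success hθ, h.measureReal_noSuccess hθ,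
      survival_succ, harm_succ]
    push_cast
    field_simp
    ring

/-- The σ-algebra generated by the numbers of arrivals up to time `t`. -/
abbrev pastSigma (N : unitInterval → Ω → ℕ) (t : unitInterval) : MeasurableSpace Ω :=
  ⨆ (s : unitInterval) (_ : s ≤ t), MeasurableSpace.comap (N s) inferInstance

/-- The σ-algebra generated by the number of arrivals after time `t`. -/
abbrev incrSigma (N : unitInterval → Ω → ℕ) (t : unitInterval) : MeasurableSpace Ω :=
  MeasurableSpace.comap (fun ω => N 1 ω - N t ω) inferInstance

omit mΩ in
lemma measurable_pastSigma {s t : unitInterval} (h : s ≤ t) : Measurable[pastSigma N t] (N s) :=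
  Measurable.of_comap_le
    (le_iSup₂_of_le (f := fun s (_ : s ≤ t) => MeasurableSpace.comap (N s) inferInstance)
      s h le_rfl)

/-- The arrivals after time `t` are independent of those before. Finitely many values of the
counting process are partial sums of increments, the process being `0` at time `0`. -/
lemma IsPoissonProcess.indep_pastSigma (h : IsPoissonProcess P Λ N) (t : unitInterval) :
    Indep (pastSigma N t) (incrSigma N t) P := by
  have hD : Measurable fun ω => N 1 ω - N t ω := (h.measurable 1).sub (h.measurable t)
  have key : IndepFun (fun ω (s : Set.Iic t) => N s ω) (fun ω => N 1 ω - N t ω) P := by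
    refine IndepFun.process_indepFun (fun s => h.measurable s) hD fun I => ?_
    set n := I.card with hn
    set e := I.orderIsoOfFin hn.symm with he
    -- the times in `I` in increasing order, preceded by `0` and followed by `t` and `1`
    set u : ℕ → unitInterval := fun i =>
      if i = 0 then 0 else if hi : i - 1 < n then ((e ⟨i - 1, hi⟩ : Set.Iic t) : unitInterval)
        else if i = n + 1 then t else 1 with hu
    have hu0 : u 0 = 0 := by simp [hu]
    have hus : ∀ i (hi : i < n), u (i + 1) = ((e ⟨i, hi⟩ : Set.Iic t) : unitInterval) := by
      intro i hi; simp [hu, hi]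
    have hut : u (n + 1) = t := by simp [hu]
    have hu1 : ∀ i, n + 2 ≤ i → u i = 1 := by
      intro i hi
      simp only [hu]
      rw [if_neg (by omega), dif_neg (by omega), if_neg (by omega)]
    have humono : Monotone u := by
      refine monotone_nat_of_le_succ fun i => ?_
      rcases i with _ | i
      · rw [hu0]; exact unitInterval.nonneg'
      rcases lt_trichotomy (i + 1) n with h1 | h1 | h1
      · rw [hus i (by omega), hus (i + 1) h1]
        exact e.monotone (show (⟨i, _⟩ : Fin n) ≤ ⟨i + 1, _⟩ from Nat.le_succ i)
      · rw [hus i (by omega), h1, hut]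
        exact (e ⟨i, by omega⟩ : Set.Iic t).2
      · rw [hu1 (i + 1 + 1) (by omega)]; exact unitInterval.le_one'
    have hind := h.indep.nat humono
    have hmeas : ∀ i, Measurable fun ω => N (u (i + 1)) ω - N (u i) ω :=
      fun i => (h.measurable _).sub (h.measurable _)
    have h2 := hind.indepFun_finset (Finset.range (n + 1)) {n + 1} (by simp) hmeas
    have htel : ∀ ω i, N (u i) ω = ∑ j ∈ Finset.range i, (N (u (j + 1)) ω - N (u j) ω) := by
      intro ω i
      induction i with
      | zero => simp [hu0, h.start]
      | succ i ih =>
        rw [Finset.sum_range_succ, ← ih]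
        have := h.mono ω (humono (Nat.le_succ i))
        simp only [Nat.succ_eq_add_one] at this
        omega
    have hφ : Measurable fun (v : Finset.range (n + 1) → ℕ) (s : I) =>
        ∑ j ∈ (Finset.range (n + 1)).attach.filter fun j => j.1 < (e.symm s : ℕ) + 1, v j :=
      measurable_pi_lambda _ fun s => Finset.measurable_sum _ fun j _ => measurable_pi_apply j
    have hψ : Measurable fun v : ({n + 1} : Finset ℕ) → ℕ =>
        v ⟨n + 1, Finset.mem_singleton_self _⟩ :=
      measurable_pi_apply _
    have h3 := h2.comp hφ hψ
    convert h3 using 1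
    · funext ω s
      have hs : ((s : Set.Iic t) : unitInterval) = u ((e.symm s : ℕ) + 1) := by
        rw [hus _ (e.symm s).2]; simp
      have hlt : (e.symm s : ℕ) < n := (e.symm s).2
      simp only [Function.comp]
      rw [hs, htel ω, Finset.sum_filter, Finset.sum_attach (Finset.range (n + 1))
        (fun j => if j < (e.symm s : ℕ) + 1 then N (u (j + 1)) ω - N (u j) ω else 0),
        ← Finset.sum_filter]
      refine Finset.sum_congr ?_ fun _ _ => rfl
      ext j
      simp only [Finset.mem_range, Finset.mem_filter]
      omega
    · funext ω
      simp only [Function.comp]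
      rw [hut, hu1 _ le_rfl]
  rw [IndepFun_iff_Indep] at key
  refine indep_of_indep_of_le_left key (iSup₂_le fun s hs => ?_)
  exact Measurable.comap_le ((measurable_pi_apply (⟨s, hs⟩ : Set.Iic t)).comp
    (comap_measurable fun ω (s : Set.Iic t) => N s ω))

/-- The arrivals up to time `t` and the first `k` outcomes are independent of the number of later
arrivals and of the later outcomes. -/
lemma IsModel.indep_past_future (h : IsModel P θ Λ N X) (t : unitInterval) (k : ℕ) :
    Indep (pastSigma N t ⊔ trialsSigma X (Set.Iio k))
      (incrSigma N t ⊔ trialsSigma X (Set.Ici k)) P := by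
  have hN := h.poisson.measurable
  refine Indep.sup_sup_comm (iSup₂_le fun s _ => (hN s).comap_le) ((hN 1).sub (hN t)).comap_le
    (h.trialsSigma_le _) (h.trialsSigma_le _) (h.poisson.indep_pastSigma t)
    (h.indep_trialsSigma (Set.disjoint_left.2 fun n (h1 : n < k) (h2 : k ≤ n) =>
      absurd h1 (not_lt.2 h2))) ?_
  have h1 := h.indep_arrivals
  rw [IndepFun_iff_Indep] at h1
  have hNm : ∀ s, Measurable[MeasurableSpace.comap (fun ω t => N t ω) MeasurableSpace.pi] (N s) :=
    fun s => (measurable_pi_apply s).comp (comap_measurable fun ω t => N t ω)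
  have hXm : ∀ n, Measurable[MeasurableSpace.comap (fun ω (n : ℕ) => X (n + 1) ω)
      MeasurableSpace.pi] (X (n + 1)) :=
    fun n => (measurable_pi_apply n).comp (comap_measurable fun ω (n : ℕ) => X (n + 1) ω)
  refine indep_of_indep_of_le h1 (sup_le (iSup₂_le fun s _ => (hNm s).comap_le)
    ((hNm 1).sub (hNm t)).comap_le) (sup_le ?_ ?_)
  · exact iSup₂_le fun n _ => (hXm n).comap_le
  · exact iSup₂_le fun n _ => (hXm n).comap_le

omit mΩ in
/-- On the event `N t = k`, the history up to time `t` is generated by the arrivals up to time `t`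
and the outcomes of the first `k` trials. -/
lemma measurableSet_history_inter (hmono : ∀ ω, Monotone fun t => N t ω) {t : unitInterval} {k : ℕ}
    {B : Set Ω} (hB : MeasurableSet[history N X t] B) :
    MeasurableSet[pastSigma N t ⊔ trialsSigma X (Set.Iio k)] (B ∩ N t ⁻¹' {k}) := by
  set 𝒢 := pastSigma N t ⊔ trialsSigma X (Set.Iio k) with h𝒢
  have hN : ∀ s ≤ t, Measurable[𝒢] (N s) :=
    fun s hs => (measurable_pastSigma hs).mono le_sup_left le_rfl
  have hX : ∀ n < k, Measurable[𝒢] (X (n + 1)) :=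
    fun n hn => (measurable_trialsSigma (S := Set.Iio k) hn).mono le_sup_right le_rfl
  have hE : MeasurableSet[𝒢] (N t ⁻¹' {k}) := hN t le_rfl trivial
  let m : MeasurableSpace Ω :=
    { MeasurableSet' := fun B => MeasurableSet[𝒢] (B ∩ N t ⁻¹' {k})
      measurableSet_empty := by rw [Set.empty_inter]; exact @MeasurableSet.empty _ 𝒢
      measurableSet_compl := fun B hB => by
        rw [show Bᶜ ∩ N t ⁻¹' {k} = N t ⁻¹' {k} \ (B ∩ N t ⁻¹' {k}) by
          ext; simp; tauto]
        exact hE.diff hB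
      measurableSet_iUnion := fun f hf => by
        rw [Set.iUnion_inter]; exact MeasurableSet.iUnion hf }
  suffices hle : history N X t ≤ m from hle B hB
  refine iSup₂_le fun s hs => ?_
  rintro _ ⟨A, hA, rfl⟩
  have hg : Measurable[𝒢] fun ω => ((N s ω, fun n : ℕ => if n < k then
      decide (n + 1 ≤ N s ω) && X (n + 1) ω else false) : ℕ × (ℕ → Bool)) := by
    refine (hN s hs).prodMk (@measurable_pi_lambda _ _ _ 𝒢 _ _ fun n => ?_)
    by_cases hn : n < k
    · simp only [hn, if_true]
      exact (measurable_of_countable fun p : ℕ × Bool => decide (n + 1 ≤ p.1) && p.2).comp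
        ((hN s hs).prodMk (hX n hn))
    · simp only [hn, if_false]
      exact @measurable_const _ _ _ 𝒢 _
  change MeasurableSet[𝒢] _
  convert (hg hA).inter hE using 1
  ext ω
  simp only [Set.mem_inter_iff, Set.mem_preimage, Set.mem_singleton_iff, and_congr_left_iff]
  intro hk
  have : (fun n : ℕ => decide (n + 1 ≤ N s ω) && X (n + 1) ω) = fun n : ℕ => if n < k then
      decide (n + 1 ≤ N s ω) && X (n + 1) ω else false := by
    funext n
    by_cases hn : n < k
    · simp [hn]
    · have h1 : N s ω ≤ k := hk ▸ hmono ω hs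
      rw [if_neg hn, decide_eq_false (by omega), Bool.false_and]
  rw [this]

omit [IsProbabilityMeasure P] in
lemma IsPoissonProcess.measureReal_increment (h : IsPoissonProcess P Λ N) (hΛ : Monotone Λ)
    {s t : unitInterval} (hst : s ≤ t) (n : ℕ) :
    P.real {ω | N t ω - N s ω = n}
      = Real.exp (-(Λ t - Λ s)) * ((Λ t - Λ s) ^ n / (n.factorial : ℝ)) := by
  have h1 := (h.law s t hst).measureReal_eq (p := fun m => m = n) trivial
  rw [h1]
  change (poissonMeasure (Λ t - Λ s).toNNReal).real {n} = _
  rw [poissonMeasure_real_singleton, Real.coe_toNNReal _ (sub_nonneg.2 (hΛ hst)), mul_div_assoc]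

/-- The Markov property at a fixed time `t`, given that `k` trials have arrived. -/
lemma IsModel.hasSum_measureReal_inter (h : IsModel P θ Λ N X) (hΛ : Monotone Λ)
    {t : unitInterval} {k : ℕ} {B : Set Ω} (hB : MeasurableSet[history N X t] B)
    (hBk : ∀ ω ∈ B, N t ω = k) {E : ℕ → Set Ω}
    (hE : ∀ n, MeasurableSet[trialsSigma X (Set.Ici k)] (E n)) :
    HasSum (fun n : ℕ => P.real B * (Real.exp (-(Λ 1 - Λ t)) * (P.real (E n) *
      ((Λ 1 - Λ t) ^ n / (n.factorial : ℝ))))) (P.real (B ∩ {ω | ω ∈ E (N 1 ω - k)})) := by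
  have hN := h.poisson.measurable
  have hD : Measurable fun ω => N 1 ω - N t ω := (hN 1).sub (hN t)
  have hBm : MeasurableSet B := history_le hN h.measurable t B hB
  have hEm : ∀ n, MeasurableSet (E n) := fun n => h.trialsSigma_le _ _ (hE n)
  set F : ℕ → Set Ω := fun n => B ∩ ({ω | N 1 ω - N t ω = n} ∩ E n) with hF
  have hFm : ∀ n, MeasurableSet (F n) := fun n =>
    hBm.inter ((hD (measurableSet_singleton n)).inter (hEm n))
  have hunion : B ∩ {ω | ω ∈ E (N 1 ω - k)} = ⋃ n, F n := by
    ext ω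
    simp only [hF, Set.mem_inter_iff, Set.mem_ofPred_eq, Set.mem_iUnion]
    constructor
    · rintro ⟨h1, h2⟩
      exact ⟨N 1 ω - k, h1, by rw [hBk ω h1], h2⟩
    · rintro ⟨n, h1, h2, h3⟩
      refine ⟨h1, ?_⟩
      rw [hBk ω h1] at h2
      rwa [h2]
  have hdisj : Pairwise (Function.onFun Disjoint F) := fun i j hij =>
    Set.disjoint_left.2 fun ω h1 h2 => hij (h1.2.1.symm.trans h2.2.1)
  have hind := h.indep_past_future t k
  rw [Indep_iff] at hind
  have hBG : MeasurableSet[pastSigma N t ⊔ trialsSigma X (Set.Iio k)] B := by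
    have := measurableSet_history_inter (k := k) h.poisson.mono hB
    rwa [Set.inter_eq_left.2 (show B ⊆ N t ⁻¹' {k} from hBk)] at this
  have hDm : ∀ n, MeasurableSet[incrSigma N t] {ω | N 1 ω - N t ω = n} := fun n =>
    ⟨{n}, trivial, rfl⟩
  have hDE : ∀ n, P ({ω | N 1 ω - N t ω = n} ∩ E n)
      = P {ω | N 1 ω - N t ω = n} * P (E n) := fun n => by
    have h1 := h.indep_arrivals
    rw [IndepFun_iff_Indep, Indep_iff] at h1
    refine h1 _ _ ?_ ?_
    · refine (show incrSigma N t ≤ _ from Measurable.comap_le ?_) _ (hDm n)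
      exact ((measurable_pi_apply 1).comp (comap_measurable fun ω t => N t ω)).sub
        ((measurable_pi_apply t).comp (comap_measurable fun ω t => N t ω))
    · refine (show trialsSigma X (Set.Ici k) ≤ _ from ?_) _ (hE n)
      exact iSup₂_le fun n _ =>
        ((measurable_pi_apply n).comp (comap_measurable fun ω (n : ℕ) => X (n + 1) ω)).comap_le
  have hterm : ∀ n, P.real (F n) = P.real B * (Real.exp (-(Λ 1 - Λ t)) * (P.real (E n) *
      ((Λ 1 - Λ t) ^ n / (n.factorial : ℝ)))) := fun n => by
    have h1 : P (F n) = P B * (P {ω | N 1 ω - N t ω = n} * P (E n)) := by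
      rw [← hDE n]
      exact hind _ _ hBG (((le_sup_left : incrSigma N t ≤ _) _ (hDm n)).inter
        ((le_sup_right : trialsSigma X (Set.Ici k) ≤ _) _ (hE n)))
    rw [measureReal_def, h1, ENNReal.toReal_mul, ENNReal.toReal_mul]
    simp only [← measureReal_def]
    rw [h.poisson.measureReal_increment hΛ unitInterval.le_one']
    ring
  rw [hunion]
  simp only [← hterm]
  exact hasSum_measureReal_iUnion hdisj hFm

/-- The conditional probability, given that the `k`-th trial arrives at time `t`, that exactly one
of the later trials is a success, minus the conditional probability that none is. -/
noncomputable def gain (θ : ℝ) (Λ : unitInterval → ℝ) (k : ℕ) (t : unitInterval) : ℝ :=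
  Real.exp (-(Λ 1 - Λ t)) * egf (gainCoeff θ k) (Λ 1 - Λ t)

lemma IsModel.measureReal_sub_eq_gain (h : IsModel P θ Λ N X) (hθ : 0 < θ) (hΛ : Monotone Λ)
    {t : unitInterval} {k : ℕ} (hk : 1 ≤ k) {B : Set Ω} (hB : MeasurableSet[history N X t] B)
    (hBk : ∀ ω ∈ B, N t ω = k) :
    P.real (B ∩ {ω | ω ∈ oneSuccess X k (N 1 ω - k)})
      - P.real (B ∩ {ω | ω ∈ noSuccess X k (N 1 ω - k)}) = P.real B * gain θ Λ k t := by
  have h1 := h.hasSum_measureReal_inter hΛ hB hBk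
    (fun n => measurableSet_oneSuccess (X := X) (S := Set.Ici k) (k := k) (n := n) fun _ hi => hi.1)
  have h2 := h.hasSum_measureReal_inter hΛ hB hBk
    (fun n => measurableSet_noSuccess (X := X) (S := Set.Ici k) (k := k) (n := n) fun _ hi => hi.1)
  have h3 := ((summable_egf (abs_gainCoeff_le hθ hk) (Λ 1 - Λ t)).hasSum.mul_left
    (Real.exp (-(Λ 1 - Λ t)))).mul_left (P.real B)
  refine (h1.sub h2).unique (h3.congr_fun fun n => ?_)
  rw [h.measureReal_oneSuccess hθ hk, h.measureReal_noSuccess hθ, gainCoeff]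
  ring

end Model

/-! ### Approximation by finite time grids -/

/-- A grid of `[0, 1]` in whose cells two continuous functions oscillate by at most `ε`; the last
cell `[t m, 1]` is nondegenerate. -/
lemma exists_grid {f g : unitInterval → ℝ} (hf : Continuous f) (hg : Continuous g) {ε : ℝ}
    (hε : 0 < ε) : ∃ (m : ℕ) (t : ℕ → unitInterval), t 0 = 0 ∧ Monotone t ∧ t m < 1 ∧
      t (m + 1) = 1 ∧ ∀ i, ∀ s ∈ Set.Icc (t i) (t (i + 1)),
        |f (t (i + 1)) - f s| ≤ ε ∧ |g (t (i + 1)) - g s| ≤ ε := by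
  obtain ⟨t, h0, hmono, ⟨n, hn⟩, hcov⟩ := exists_monotone_Icc_subset_open_cover_unitInterval
    (c := fun u : unitInterval => {s | |f s - f u| < ε / 2 ∧ |g s - g u| < ε / 2})
    (fun u => (isOpen_lt (f := fun s => |f s - f u|) (by fun_prop) continuous_const).inter
      (isOpen_lt (f := fun s => |g s - g u|) (by fun_prop) continuous_const))
    (fun u _ => Set.mem_iUnion.2 ⟨u, by simp [hε]⟩)
  classical
  have hex : ∃ n, t n = 1 := ⟨n, hn n le_rfl⟩
  obtain ⟨m, hm⟩ : ∃ m, Nat.find hex = m + 1 := by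
    refine Nat.exists_eq_succ_of_ne_zero fun h => ?_
    have h1 := Nat.find_spec hex
    rw [h, h0] at h1
    exact zero_ne_one h1
  refine ⟨m, t, h0, hmono, ?_, hm ▸ Nat.find_spec hex, fun i s hs => ?_⟩
  · exact unitInterval.lt_one_iff_ne_one.2 (Nat.find_min hex (by omega))
  · obtain ⟨u, hu⟩ := hcov i
    obtain ⟨h1, h2⟩ := hu hs
    obtain ⟨h3, h4⟩ := hu (Set.right_mem_Icc.2 (hmono (Nat.le_succ i)))
    rw [abs_lt] at h1 h2 h3 h4
    exact ⟨abs_le.2 ⟨by linarith, by linarith⟩, abs_le.2 ⟨by linarith, by linarith⟩⟩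

lemma nonpos_of_forall_le_mul {a C : ℝ} (hC : 0 ≤ C) (h : ∀ ε, 0 < ε → a ≤ C * ε) : a ≤ 0 := by
  by_contra! ha
  have h1 := h (a / (2 * (C + 1))) (by positivity)
  rw [mul_div_assoc', le_div_iff₀ (by positivity)] at h1
  nlinarith

section Grid
variable {Ω : Type*} {N : unitInterval → Ω → ℕ} {t : ℕ → unitInterval} {m : ℕ} {ω : Ω}

/-- The exceptional event for the grid `t 0, …, t (m + 1)`: some cell has at least two arrivals,
or there is an arrival in the last cell. -/
def crowded (N : unitInterval → Ω → ℕ) (t : ℕ → unitInterval) (m : ℕ) : Set Ω :=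
  {ω | N (t m) ω < N 1 ω} ∪ ⋃ i ∈ Finset.range (m + 1), {ω | N (t i) ω + 2 ≤ N (t (i + 1)) ω}

/-- Each arrival falls into a cell of the grid. -/
lemma exists_cell (h0 : N 0 ω = 0) (ht0 : t 0 = 0) (ht1 : t (m + 1) = 1) {k : ℕ} (hk : 1 ≤ k)
    (hkN : k ≤ N 1 ω) : ∃ i ∈ Finset.range (m + 1), N (t i) ω < k ∧ k ≤ N (t (i + 1)) ω := by
  classical
  have hex : ∃ j, k ≤ N (t j) ω := ⟨m + 1, by rwa [ht1]⟩
  obtain ⟨i, hi⟩ : ∃ i, Nat.find hex = i + 1 := by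
    refine Nat.exists_eq_succ_of_ne_zero fun h => ?_
    have h1 := Nat.find_spec hex
    rw [h, ht0, h0] at h1
    omega
  have hle : Nat.find hex ≤ m + 1 := Nat.find_min' hex (by rwa [ht1])
  exact ⟨i, by simp; omega, not_le.1 (Nat.find_min hex (by omega)), hi ▸ Nat.find_spec hex⟩

lemma lt_arrivalTime_of_lt (hmono : Monotone fun t => N t ω)
    (hcont : ∀ t, ContinuousWithinAt (fun s => N s ω) (Set.Ici t) t) {k : ℕ} (hk : k ≤ N 1 ω)
    {s : unitInterval} (h : N s ω < k) : s < arrivalTime N k ω :=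
  not_le.1 fun hle => not_le.2 h ((arrivalTime_le_iff hmono hcont hk).1 hle)

/-- Arrivals are simultaneous, or at time `1`, only on exceptional events of the grids. -/
lemma mem_crowded_of_not_strictMono (h0 : N 0 ω = 0) (hmono : Monotone fun t => N t ω)
    (hcont : ∀ t, ContinuousWithinAt (fun s => N s ω) (Set.Ici t) t) (ht0 : t 0 = 0)
    (htm : t m < 1) (ht1 : t (m + 1) = 1)
    (h : ¬ ((∀ j k, j < k → k ≤ N 1 ω → arrivalTime N j ω < arrivalTime N k ω) ∧
      ∀ k, 1 ≤ k → k ≤ N 1 ω → arrivalTime N k ω < 1)) : ω ∈ crowded N t m := by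
  rw [not_and_or] at h
  push Not at h
  rcases h with ⟨j, k, hjk, hk, hle⟩ | ⟨k, hk1, hk, hle⟩
  · obtain ⟨i, hi, h1, h2⟩ := exists_cell h0 ht0 ht1 (show 1 ≤ k by omega) hk
    refine Or.inr (Set.mem_biUnion hi ?_)
    have h3 := (lt_arrivalTime_of_lt hmono hcont hk h1).trans_le hle
    have h4 : N (t i) ω < j :=
      not_le.1 fun h5 => not_le.2 h3 (arrivalTime_le_of_le h5)
    change _ + 2 ≤ _
    omega
  · refine Or.inl ?_
    have h3 := htm.trans_le hle
    exact (not_le.1 fun h5 => not_le.2 h3 (arrivalTime_le_of_le h5) : N (t m) ω < k).trans_le hk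

end Grid

section Model
variable {Ω : Type*} [mΩ : MeasurableSpace Ω] {P : Measure Ω} [IsProbabilityMeasure P]
  {θ : ℝ} {Λ : unitInterval → ℝ} {N : unitInterval → Ω → ℕ} {X : ℕ → Ω → Bool}

lemma IsPoissonProcess.measureReal_lt_le (h : IsPoissonProcess P Λ N) (hΛ : Monotone Λ)
    {s t : unitInterval} (hst : s ≤ t) : P.real {ω | N s ω < N t ω} ≤ Λ t - Λ s := by
  have hD : Measurable fun ω => N t ω - N s ω := (h.measurable t).sub (h.measurable s)
  have e : {ω | N s ω < N t ω} = {ω | N t ω - N s ω = 0}ᶜ := by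
    ext ω
    have := h.mono ω hst
    simp only [Set.mem_ofPred_eq, Set.mem_compl_iff]
    omega
  have hm0 : MeasurableSet {ω | N t ω - N s ω = 0} := hD (measurableSet_singleton 0)
  rw [e, probReal_compl_eq_one_sub hm0, h.measureReal_increment hΛ hst]
  have h1 := Real.add_one_le_exp (-(Λ t - Λ s))
  simp only [pow_zero, Nat.factorial_zero, Nat.cast_one, div_one, mul_one]
  linarith

lemma IsPoissonProcess.measureReal_add_two_le_le (h : IsPoissonProcess P Λ N) (hΛ : Monotone Λ)
    {s t : unitInterval} (hst : s ≤ t) :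
    P.real {ω | N s ω + 2 ≤ N t ω} ≤ (Λ t - Λ s) ^ 2 := by
  have hD : Measurable fun ω => N t ω - N s ω := (h.measurable t).sub (h.measurable s)
  have e : {ω | N s ω + 2 ≤ N t ω} = ({ω | N t ω - N s ω = 0} ∪ {ω | N t ω - N s ω = 1})ᶜ := by
    ext ω
    have := h.mono ω hst
    simp only [Set.mem_ofPred_eq, Set.mem_compl_iff, Set.mem_union]
    omega
  have hm0 : MeasurableSet {ω | N t ω - N s ω = 0} := hD (measurableSet_singleton 0)
  have hm1 : MeasurableSet {ω | N t ω - N s ω = 1} := hD (measurableSet_singleton 1)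
  rw [e, probReal_compl_eq_one_sub (hm0.union hm1), measureReal_union
    (Set.disjoint_left.2 fun ω h1 h2 => zero_ne_one (h1.symm.trans h2)) hm1,
    h.measureReal_increment hΛ hst, h.measureReal_increment hΛ hst]
  have h1 := Real.add_one_le_exp (-(Λ t - Λ s))
  have h2 := sub_nonneg.2 (hΛ hst)
  simp only [pow_zero, Nat.factorial_zero, Nat.cast_one, div_one, mul_one, pow_one,
    Nat.factorial_one]
  nlinarith

/-- A cell of mean `d ≤ ε` has two arrivals with probability at most `d ^ 2 ≤ d * ε`. -/
lemma IsPoissonProcess.measureReal_crowded_le (h : IsPoissonProcess P Λ N) (hΛ : Monotone Λ)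
    (hΛ0 : Λ 0 = 0) {ε : ℝ} {m : ℕ} {t : ℕ → unitInterval} (ht0 : t 0 = 0) (ht : Monotone t)
    (ht1 : t (m + 1) = 1) (hε : ∀ i, Λ (t (i + 1)) - Λ (t i) ≤ ε) :
    P.real (crowded N t m) ≤ (Λ 1 + 1) * ε := by
  have hle : ∀ i, t i ≤ t (i + 1) := fun i => ht (Nat.le_succ i)
  have h1 : P.real {ω | N (t m) ω < N 1 ω} ≤ ε := by
    have := h.measureReal_lt_le hΛ (hle m)
    rw [ht1] at this
    have h2 := hε m
    rw [ht1] at h2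
    linarith
  have h2 : P.real (⋃ i ∈ Finset.range (m + 1), {ω | N (t i) ω + 2 ≤ N (t (i + 1)) ω})
      ≤ Λ 1 * ε := by
    refine (measureReal_biUnion_finset_le _ _).trans ?_
    calc _ ≤ ∑ i ∈ Finset.range (m + 1), (Λ (t (i + 1)) - Λ (t i)) * ε := by
          refine Finset.sum_le_sum fun i _ => (h.measureReal_add_two_le_le hΛ (hle i)).trans ?_
          have := sub_nonneg.2 (hΛ (hle i))
          rw [sq]
          exact mul_le_mul_of_nonneg_left (hε i) this
      _ = Λ 1 * ε := by
          rw [← Finset.sum_mul, Finset.sum_range_sub (fun i => Λ (t i)), ht1, ht0, hΛ0, sub_zero]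
  refine (measureReal_union_le _ _).trans ?_
  linarith

/-- Almost surely, no two trials arrive simultaneously, and none at time `1`. -/
lemma IsPoissonProcess.ae_strictMono_arrivalTime (h : IsPoissonProcess P Λ N) (hΛ : Monotone Λ)
    (hΛc : Continuous Λ) (hΛ0 : Λ 0 = 0) :
    ∀ᵐ ω ∂P, (∀ j k, j < k → k ≤ N 1 ω → arrivalTime N j ω < arrivalTime N k ω) ∧
      ∀ k, 1 ≤ k → k ≤ N 1 ω → arrivalTime N k ω < 1 := by
  rw [ae_iff, ← measureReal_eq_zero_iff]
  refine le_antisymm (nonpos_of_forall_le_mul (C := Λ 1 + 1) ?_ fun ε hε => ?_) measureReal_nonneg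
  · have := hΛ (unitInterval.nonneg' (t := 1))
    linarith
  · obtain ⟨m, t, ht0, ht, htm, ht1, hosc⟩ := exists_grid hΛc hΛc hε
    refine le_trans (measureReal_mono fun ω hω => ?_) (h.measureReal_crowded_le hΛ hΛ0 ht0 ht ht1
      fun i => (le_abs_self _).trans (hosc i (t i) ⟨le_rfl, ht (Nat.le_succ i)⟩).1)
    exact mem_crowded_of_not_strictMono (h.start ω) (h.mono ω) (h.rightCont ω) ht0 htm ht1 hω

/-! ### The Markov property at arrival epochs -/

/-- The event that the `k`-th trial is a success, and is passed over by `τ`. -/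
def passed (N : unitInterval → Ω → ℕ) (X : ℕ → Ω → Bool) (τ : Ω → unitInterval) (k : ℕ) : Set Ω :=
  {ω | 1 ≤ k ∧ k ≤ N 1 ω ∧ X k ω = true ∧ arrivalTime N k ω < τ ω}

/-- The event that exactly one trial after the `k`-th is a success. -/
def oneLater (N : unitInterval → Ω → ℕ) (X : ℕ → Ω → Bool) (k : ℕ) : Set Ω :=
  {ω | ω ∈ oneSuccess X k (N 1 ω - k)}

/-- The event that no trial after the `k`-th is a success. -/
def noneLater (N : unitInterval → Ω → ℕ) (X : ℕ → Ω → Bool) (k : ℕ) : Set Ω :=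
  {ω | ω ∈ noSuccess X k (N 1 ω - k)}

omit [IsProbabilityMeasure P] in
lemma IsModel.measurableSet_mem_comp (h : IsModel P θ Λ N X) {k : ℕ} {E : ℕ → Set Ω}
    (hE : ∀ n, MeasurableSet (E n)) : MeasurableSet {ω | ω ∈ E (N 1 ω - k)} := by
  have : {ω | ω ∈ E (N 1 ω - k)} = ⋃ n, N 1 ⁻¹' {n} ∩ E (n - k) := by
    ext ω; simp
  rw [this]
  exact MeasurableSet.iUnion fun n =>
    (h.poisson.measurable 1 (measurableSet_singleton n)).inter (hE _)

omit [IsProbabilityMeasure P] in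
lemma IsModel.measurableSet_oneLater (h : IsModel P θ Λ N X) (k : ℕ) :
    MeasurableSet (oneLater N X k) :=
  h.measurableSet_mem_comp fun _ =>
    h.trialsSigma_le (Set.Ici k) _ (measurableSet_oneSuccess fun _ hi => hi.1)

omit [IsProbabilityMeasure P] in
lemma IsModel.measurableSet_noneLater (h : IsModel P θ Λ N X) (k : ℕ) :
    MeasurableSet (noneLater N X k) :=
  h.measurableSet_mem_comp fun _ =>
    h.trialsSigma_le (Set.Ici k) _ (measurableSet_noSuccess fun _ hi => hi.1)

omit [IsProbabilityMeasure P] in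
lemma IsModel.measurableSet_passed (h : IsModel P θ Λ N X) {τ : Ω → unitInterval}
    (hτ : IsStrategy N X τ) (k : ℕ) : MeasurableSet (passed N X τ k) := by
  by_cases hk : 1 ≤ k
  · have e : passed N X τ k = N 1 ⁻¹' Set.Ici k ∩ (X k ⁻¹' {true} ∩
        {ω | arrivalTime N k ω < τ ω}) := by
      ext ω; simp [passed, hk]
    rw [e]
    exact (h.poisson.measurable 1 trivial).inter ((h.measurable k hk trivial).inter
      (measurableSet_lt (h.poisson.measurable_arrivalTime k)
        (hτ.measurable h.poisson.measurable h.measurable)))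
  · have e : passed N X τ k = ∅ := by ext ω; simp [passed, hk]
    rw [e]; exact MeasurableSet.empty

lemma continuous_gain (hθ : 0 < θ) (hΛc : Continuous Λ) {k : ℕ} (hk : 1 ≤ k) :
    Continuous (gain θ Λ k) :=
  (Real.continuous_exp.comp (by fun_prop)).mul
    ((continuous_egf (abs_gainCoeff_le hθ hk)).comp (by fun_prop))

/-- The outcomes after the `k`-th trial, compared with their conditional expectation. -/
noncomputable def deviation (θ : ℝ) (Λ : unitInterval → ℝ) (N : unitInterval → Ω → ℕ)
    (X : ℕ → Ω → Bool) (k : ℕ) (ω : Ω) : ℝ :=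
  (oneLater N X k).indicator 1 ω - (noneLater N X k).indicator 1 ω
    - gain θ Λ k (arrivalTime N k ω)

lemma IsModel.exists_deviation_bound (h : IsModel P θ Λ N X) (hθ : 0 < θ) (hΛc : Continuous Λ)
    {k : ℕ} (hk : 1 ≤ k) : ∃ C, 0 ≤ C ∧ (∀ ω, ‖deviation θ Λ N X k ω‖ ≤ C) ∧
      Integrable (fun ω => gain θ Λ k (arrivalTime N k ω)) P ∧
      Integrable (deviation θ Λ N X k) P := by
  have hg := continuous_gain hθ hΛc hk
  obtain ⟨G, hG⟩ := isCompact_univ.exists_bound_of_continuousOn hg.continuousOn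
  have hG0 : 0 ≤ G := (norm_nonneg _).trans (hG 0 trivial)
  have i1 : Integrable (fun ω => gain θ Λ k (arrivalTime N k ω)) P :=
    Integrable.of_bound (hg.measurable.comp
      (h.poisson.measurable_arrivalTime k)).aestronglyMeasurable G
      (Filter.Eventually.of_forall fun ω => hG _ trivial)
  have i2 : Integrable ((oneLater N X k).indicator (1 : Ω → ℝ)) P :=
    (integrable_const (1 : ℝ)).indicator (h.measurableSet_oneLater k)
  have i3 : Integrable ((noneLater N X k).indicator (1 : Ω → ℝ)) P :=
    (integrable_const (1 : ℝ)).indicator (h.measurableSet_noneLater k)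
  refine ⟨2 + G, by linarith, fun ω => ?_, i1, (i2.sub i3).sub i1⟩
  have h1 : ∀ S : Set Ω, ‖S.indicator (1 : Ω → ℝ) ω‖ ≤ 1 := fun S =>
    (norm_indicator_le_norm_self _ _).trans (by simp)
  calc _ ≤ ‖(oneLater N X k).indicator (1 : Ω → ℝ) ω‖ + ‖(noneLater N X k).indicator (1 : Ω → ℝ) ω‖
        + ‖gain θ Λ k (arrivalTime N k ω)‖ :=
        (norm_sub_le _ _).trans (add_le_add_left (norm_sub_le _ _) _)
    _ ≤ 1 + 1 + G := add_le_add (add_le_add (h1 _) (h1 _)) (hG _ trivial)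
    _ = _ := by ring

lemma IsModel.setIntegral_deviation (h : IsModel P θ Λ N X) (hθ : 0 < θ) (hΛc : Continuous Λ)
    {k : ℕ} (hk : 1 ≤ k) (B : Set Ω) :
    ∫ ω in B, deviation θ Λ N X k ω ∂P = P.real (B ∩ oneLater N X k)
      - P.real (B ∩ noneLater N X k) - ∫ ω in B, gain θ Λ k (arrivalTime N k ω) ∂P := by
  obtain ⟨-, -, -, i1, -⟩ := h.exists_deviation_bound hθ hΛc hk
  have i2 : Integrable ((oneLater N X k).indicator (1 : Ω → ℝ)) P :=
    (integrable_const (1 : ℝ)).indicator (h.measurableSet_oneLater k)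
  have i3 : Integrable ((noneLater N X k).indicator (1 : Ω → ℝ)) P :=
    (integrable_const (1 : ℝ)).indicator (h.measurableSet_noneLater k)
  have e : ∀ S : Set Ω, MeasurableSet S →
      ∫ ω in B, S.indicator (1 : Ω → ℝ) ω ∂P = P.real (B ∩ S) := fun S hS => by
    rw [setIntegral_indicator hS]; simp
  simp only [deviation]
  refine (integral_sub (i2.sub i3).integrableOn i1.integrableOn).trans (congrArg (· - _) ?_)
  refine (integral_sub i2.integrableOn i3.integrableOn).trans ?_
  rw [e _ (h.measurableSet_oneLater k), e _ (h.measurableSet_noneLater k)]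

/-- The event that the `k`-th trial, a success, is the last to arrive in the time interval
`(s, t]`, and that `τ` has not stopped by time `t`. -/
def passedCell (N : unitInterval → Ω → ℕ) (X : ℕ → Ω → Bool) (τ : Ω → unitInterval) (k : ℕ)
    (s t : unitInterval) : Set Ω :=
  {ω | N s ω < k ∧ N t ω = k ∧ (k ≤ N t ω ∧ X k ω = true) ∧ t < τ ω}

omit mΩ in
lemma measurableSet_passedCell {τ : Ω → unitInterval} (hτ : IsStrategy N X τ) {k : ℕ} (hk : 1 ≤ k)
    {s t : unitInterval} (hst : s ≤ t) :
    MeasurableSet[history N X t] (passedCell N X τ k s t) := by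
  have h1 : MeasurableSet[history N X t] {ω | N s ω < k} :=
    measurable_count_history hst (measurableSet_Iio (a := k))
  have h2 : MeasurableSet[history N X t] {ω | N t ω = k} :=
    measurable_count_history le_rfl (measurableSet_singleton k)
  have h3 : MeasurableSet[history N X t] {ω | t < τ ω} := by
    convert (hτ.adapted t).compl using 1
    ext ω; simp
  exact h1.inter (h2.inter ((measurableSet_history_success le_rfl hk).inter h3))

/-- The Markov property at the fixed time `t`, applied to a single cell `(s, t]` on which `gain`
is nearly constant. -/
lemma IsModel.norm_setIntegral_passedCell_le (h : IsModel P θ Λ N X) (hθ : 0 < θ)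
    (hΛ : Monotone Λ) (hΛc : Continuous Λ) {τ : Ω → unitInterval} (hτ : IsStrategy N X τ) {k : ℕ}
    (hk : 1 ≤ k) {s t : unitInterval} (hst : s ≤ t) {ε : ℝ}
    (hε : ∀ u ∈ Set.Icc s t, |gain θ Λ k t - gain θ Λ k u| ≤ ε) :
    ‖∫ ω in passedCell N X τ k s t, deviation θ Λ N X k ω ∂P‖
      ≤ ε * P.real (passedCell N X τ k s t) := by
  set B := passedCell N X τ k s t with hB
  have hBh := measurableSet_passedCell hτ hk hst
  have hBm : MeasurableSet B := history_le h.poisson.measurable h.measurable t _ hBh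
  obtain ⟨-, -, -, i1, -⟩ := h.exists_deviation_bound hθ hΛc hk
  have e1 : P.real (B ∩ oneLater N X k) - P.real (B ∩ noneLater N X k) = P.real B * gain θ Λ k t :=
    h.measureReal_sub_eq_gain hθ hΛ hk hBh fun ω hω => hω.2.1
  have e2 : P.real B * gain θ Λ k t = ∫ _ω in B, gain θ Λ k t ∂P := by simp
  rw [h.setIntegral_deviation hθ hΛc hk, e1, e2,
    ← integral_sub (integrable_const _) i1.integrableOn]
  refine norm_setIntegral_le_of_norm_le_const (measure_lt_top _ _) fun ω hω => ?_
  obtain ⟨h1, h2, -, -⟩ := hω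
  have hkN : k ≤ N 1 ω := h2 ▸ h.poisson.mono ω unitInterval.le_one'
  exact hε _ ⟨(lt_arrivalTime_of_lt (h.poisson.mono ω) (h.poisson.rightCont ω) hkN h1).le,
    arrivalTime_le_of_le h2.ge⟩

/-- The Markov property at the epoch of the `k`-th trial. Up to an exceptional event of small
probability, the event `passed N X τ k` is the disjoint union over the cells of a fine grid of the
events `passedCell`, which belong to the history at the right end of the cell. -/
lemma IsModel.measureReal_passed_sub (h : IsModel P θ Λ N X) (hθ : 0 < θ)
    (hΛ : Monotone Λ) (hΛc : Continuous Λ) (hΛ0 : Λ 0 = 0) {τ : Ω → unitInterval}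
    (hτ : IsStrategy N X τ) {k : ℕ} (hk : 1 ≤ k) :
    P.real (passed N X τ k ∩ oneLater N X k) - P.real (passed N X τ k ∩ noneLater N X k)
      = ∫ ω in passed N X τ k, gain θ Λ k (arrivalTime N k ω) ∂P := by
  rw [← sub_eq_zero, ← h.setIntegral_deviation hθ hΛc hk, ← norm_eq_zero]
  obtain ⟨C, hC, hbound, -, hint⟩ := h.exists_deviation_bound hθ hΛc hk
  have hΛ1 : 0 ≤ Λ 1 := hΛ0 ▸ hΛ unitInterval.nonneg'
  refine le_antisymm (nonpos_of_forall_le_mul (C := 1 + C * (Λ 1 + 1)) (by positivity)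
    fun ε hε => ?_) (norm_nonneg _)
  obtain ⟨m, t, ht0, ht, htm, ht1, hosc⟩ := exists_grid hΛc (continuous_gain hθ hΛc hk) hε
  have hle : ∀ i, t i ≤ t (i + 1) := fun i => ht (Nat.le_succ i)
  set B : ℕ → Set Ω := fun i => passedCell N X τ k (t i) (t (i + 1)) with hB
  have hBm : ∀ i, MeasurableSet (B i) := fun i => history_le h.poisson.measurable h.measurable _ _
    (measurableSet_passedCell hτ hk (hle i))
  have hBd : Pairwise (Function.onFun Disjoint B) := by
    refine (pairwise_disjoint_on B).2 fun i j hij => Set.disjoint_left.2 fun ω h1 h2 => ?_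
    have h3 := h.poisson.mono ω (ht (show i + 1 ≤ j from hij))
    have h4 := h1.2.1
    have h5 := h2.1
    simp only at h3
    omega
  set U := ⋃ i ∈ Finset.range (m + 1), B i with hU
  have hUm : MeasurableSet U := Finset.measurableSet_biUnion _ fun i _ => hBm i
  have hUsub : U ⊆ passed N X τ k := by
    refine Set.iUnion₂_subset fun i _ ω hω => ?_
    obtain ⟨h1, h2, ⟨h3, h4⟩, h5⟩ := hω
    exact ⟨hk, h3.trans (h.poisson.mono ω unitInterval.le_one'), h4,
      (arrivalTime_le_of_le h3).trans_lt h5⟩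
  have hdiff : passed N X τ k \ U ⊆ crowded N t m := by
    rintro ω ⟨⟨-, h1, h2, h3⟩, hnot⟩
    by_contra hcr
    obtain ⟨i, hi, h4, h5⟩ := exists_cell (h.poisson.start ω) ht0 ht1 hk h1
    have h6 : ¬ N (t i) ω + 2 ≤ N (t (i + 1)) ω := fun h6 =>
      hcr (Or.inr (Set.mem_biUnion hi h6))
    have h7 : N (t (i + 1)) ω = k := by omega
    refine hnot (Set.mem_biUnion hi ⟨h4, h7, ⟨h5, h2⟩, ?_⟩)
    by_contra hτle
    rw [not_lt] at hτle
    rcases hτ.values ω with h8 | ⟨l, hl, hlN, h8⟩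
    · -- a strategy that selects no trial is undecided only in the last cell, which is empty
      rw [h8] at hτle
      have h9 : t (i + 1) = 1 := le_antisymm unitInterval.le_one' hτle
      have h10 : t i ≤ t m := ht (Nat.lt_succ_iff.1 (Finset.mem_range.1 hi))
      refine hcr (Or.inl ?_)
      change N (t m) ω < N 1 ω
      have h11 : i = m := by
        by_contra hne
        have : i + 1 ≤ m := by
          have := Finset.mem_range.1 hi
          omega
        exact absurd (h9 ▸ ht this) (not_le.2 htm)
      rw [← h11, ← h9, h7]
      exact h4
    · rw [h8] at hτle h3
      have h9 := (arrivalTime_le_iff (h.poisson.mono ω) (h.poisson.rightCont ω) hlN).1 hτle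
      exact absurd (arrivalTime_mono (N := N) (ω := ω) (h9.trans h7.le)) (not_le.2 h3)
  have hsplit := setIntegral_union (f := deviation θ Λ N X k) (μ := P)
    (Set.disjoint_sdiff_right (s := U) (t := passed N X τ k))
    ((h.measurableSet_passed hτ k).diff hUm) hint.integrableOn hint.integrableOn
  rw [Set.union_sdiff_cancel hUsub] at hsplit
  have hfirst : ‖∫ ω in U, deviation θ Λ N X k ω ∂P‖ ≤ ε := by
    rw [hU, integral_biUnion_finset _ (fun i _ => hBm i) (fun i _ j _ hij => hBd hij)
      (fun i _ => hint.integrableOn)]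
    calc _ ≤ ∑ i ∈ Finset.range (m + 1), ‖∫ ω in B i, deviation θ Λ N X k ω ∂P‖ := norm_sum_le _ _
      _ ≤ ∑ i ∈ Finset.range (m + 1), ε * P.real (B i) := Finset.sum_le_sum fun i _ =>
          h.norm_setIntegral_passedCell_le hθ hΛ hΛc hτ hk (hle i) fun u hu => (hosc i u hu).2
      _ = ε * P.real U := by
          rw [← Finset.mul_sum, hU, measureReal_biUnion_finset (fun i _ j _ hij => hBd hij)
            fun i _ => hBm i]
      _ ≤ ε * 1 := mul_le_mul_of_nonneg_left measureReal_le_one hε.le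
      _ = ε := mul_one ε
  have hsecond : ‖∫ ω in passed N X τ k \ U, deviation θ Λ N X k ω ∂P‖ ≤ C * ((Λ 1 + 1) * ε) := by
    refine (norm_setIntegral_le_of_norm_le_const (measure_lt_top _ _) fun ω _ => hbound ω).trans ?_
    refine mul_le_mul_of_nonneg_left ((measureReal_mono hdiff).trans ?_) hC
    exact h.poisson.measureReal_crowded_le hΛ hΛ0 ht0 ht ht1
      fun i => (le_abs_self _).trans (hosc i (t i) ⟨le_rfl, hle i⟩).1
  rw [hsplit]
  refine (norm_add_le _ _).trans ?_
  linarith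

end Model

/-! ### Comparison of strategies -/

section Pathwise
variable {Ω : Type*} {Λ : unitInterval → ℝ} {N : unitInterval → Ω → ℕ} {X : ℕ → Ω → Bool}
  {τ : Ω → unitInterval} {γ : ℕ → ℝ} {ω : Ω}

lemma mem_noneLater_iff {k : ℕ} (hk : k ≤ N 1 ω) :
    ω ∈ noneLater N X k ↔ ∀ j, k < j → j ≤ N 1 ω → X j ω = false := by
  change (∀ j, k < j → j ≤ k + (N 1 ω - k) → X j ω = false) ↔ _
  rw [Nat.add_sub_cancel' hk]

lemma mem_oneLater_iff {k : ℕ} (hk : k ≤ N 1 ω) :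
    ω ∈ oneLater N X k ↔ ∃ i, k < i ∧ i ≤ N 1 ω ∧ X i ω = true ∧
      ∀ j, k < j → j ≤ N 1 ω → j ≠ i → X j ω = false := by
  change (∃ i, k < i ∧ i ≤ k + (N 1 ω - k) ∧ X i ω = true ∧
    ∀ j, k < j → j ≤ k + (N 1 ω - k) → j ≠ i → X j ω = false) ↔ _
  rw [Nat.add_sub_cancel' hk]

/-- The strategy `τ` passes over the last success. -/
def passedLast (N : unitInterval → Ω → ℕ) (X : ℕ → Ω → Bool) (τ : Ω → unitInterval) : Set Ω :=
  ⋃ k, passed N X τ k ∩ noneLater N X k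

/-- The strategy `τ` passes over the last success but one. -/
def passedSecondLast (N : unitInterval → Ω → ℕ) (X : ℕ → Ω → Bool) (τ : Ω → unitInterval) :
    Set Ω :=
  ⋃ k, passed N X τ k ∩ oneLater N X k

/-- The last success is either the only one, or preceded by a last success but one. -/
lemma exists_mem_oneLater {k : ℕ} (hk1 : 1 ≤ k) (hk : k ≤ N 1 ω) (hX : X k ω = true)
    (h : ω ∈ noneLater N X k) :
    ω ∈ oneLater N X 0 ∨ ∃ j, 1 ≤ j ∧ j < k ∧ X j ω = true ∧ ω ∈ oneLater N X j := by
  classical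
  rw [mem_noneLater_iff hk] at h
  by_cases hex : ∃ j, 1 ≤ j ∧ j < k ∧ X j ω = true
  · right
    obtain ⟨j, hj⟩ := hex
    set p : ℕ → Prop := fun j => 1 ≤ j ∧ j < k ∧ X j ω = true
    obtain ⟨h1, h2, h3⟩ : p (Nat.findGreatest p k) :=
      Nat.findGreatest_spec (P := p) (m := j) (by omega) hj
    refine ⟨Nat.findGreatest p k, h1, h2, h3, (mem_oneLater_iff (by omega)).2
      ⟨k, h2, hk, hX, fun i h4 h5 h6 => ?_⟩⟩
    rcases lt_or_gt_of_ne h6 with h7 | h7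
    · have := Nat.findGreatest_is_greatest h4 h7.le
      simpa [p, h7, show 1 ≤ i by omega] using this
    · exact h i h7 h5
  · left
    push Not at hex
    refine (mem_oneLater_iff (Nat.zero_le _)).2 ⟨k, hk1, hk, hX, fun i h4 h5 h6 => ?_⟩
    rcases lt_or_gt_of_ne h6 with h7 | h7
    · simpa using hex i h4 h7
    · exact h i h7 h5

/-- A strategy that wins or passes over the last success must have passed over the last success
but one, if there is one. -/
lemma mem_oneLater_union_passedSecondLast
    (hT : ∀ j k, j < k → k ≤ N 1 ω → arrivalTime N j ω < arrivalTime N k ω)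
    (h : ω ∈ winEvent N X τ ∪ passedLast N X τ) :
    ω ∈ oneLater N X 0 ∪ passedSecondLast N X τ := by
  obtain ⟨k, hk1, hk, hX, hnone, hle⟩ : ∃ k, 1 ≤ k ∧ k ≤ N 1 ω ∧ X k ω = true ∧
      ω ∈ noneLater N X k ∧ arrivalTime N k ω ≤ τ ω := by
    rcases h with ⟨-, k, hk1, hk, hτ, hX, hnone⟩ | h
    · exact ⟨k, hk1, hk, hX, (mem_noneLater_iff hk).2 hnone, hτ.ge⟩
    · obtain ⟨k, ⟨hk1, hk, hX, hlt⟩, hnone⟩ := Set.mem_iUnion.1 h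
      exact ⟨k, hk1, hk, hX, hnone, hlt.le⟩
  rcases exists_mem_oneLater hk1 hk hX hnone with h1 | ⟨j, hj1, hjk, hXj, hone⟩
  · exact Or.inl h1
  · exact Or.inr (Set.mem_iUnion.2
      ⟨j, ⟨hj1, hjk.le.trans hk, hXj, (hT j k hjk hk).trans_le hle⟩, hone⟩)

lemma disjoint_winEvent_passedLast : Disjoint (winEvent N X τ) (passedLast N X τ) := by
  refine Set.disjoint_left.2 fun ω h1 h2 => ?_
  obtain ⟨-, k, hk1, hk, hτ, hX, hnone⟩ := h1
  obtain ⟨j, ⟨hj1, hj, hXj, hlt⟩, hnone'⟩ := Set.mem_iUnion.1 h2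
  rw [mem_noneLater_iff hj] at hnone'
  rcases lt_trichotomy j k with h | rfl | h
  · simp [hnone' k h hk] at hX
  · exact hlt.ne hτ.symm
  · simp [hnone j h hj] at hXj

lemma disjoint_oneLater_passedSecondLast :
    Disjoint (oneLater N X 0) (passedSecondLast N X τ) := by
  refine Set.disjoint_left.2 fun ω h1 h2 => ?_
  obtain ⟨k, ⟨hk1, hk, hXk, -⟩, hone⟩ := Set.mem_iUnion.1 h2
  obtain ⟨i, -, -, -, hi⟩ := (mem_oneLater_iff (Nat.zero_le _)).1 h1
  obtain ⟨j, hkj, hj, hXj, -⟩ := (mem_oneLater_iff hk).1 hone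
  have e1 : k = i := by
    by_contra hne
    simp [hi k hk1 hk hne] at hXk
  have e2 : j = i := by
    by_contra hne
    simp [hi j (by omega) hj hne] at hXj
  omega

/-- The threshold rule stops at successes only, so it either selects or passes over the last
success once it has passed over the last but one. -/
lemma mem_winEvent_union_passedLast
    (hT : ∀ k, 1 ≤ k → k ≤ N 1 ω → arrivalTime N k ω < 1)
    (h : ω ∈ oneLater N X 0 ∪ passedSecondLast N X (thresholdRule Λ γ N X)) :
    ω ∈ winEvent N X (thresholdRule Λ γ N X) ∪ passedLast N X (thresholdRule Λ γ N X) := by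
  obtain ⟨k, hk, hlt, hone⟩ : ∃ k ≤ N 1 ω, (∀ j, 1 ≤ j →
      thresholdRule Λ γ N X ω = arrivalTime N j ω → k < j) ∧ ω ∈ oneLater N X k := by
    rcases h with h | h
    · exact ⟨0, Nat.zero_le _, fun j hj _ => hj, h⟩
    · obtain ⟨k, ⟨-, hk, -, hlt⟩, hone⟩ := Set.mem_iUnion.1 h
      refine ⟨k, hk, fun j _ hτ => ?_, hone⟩
      by_contra hjk
      exact absurd (arrivalTime_mono (not_lt.1 hjk)) (not_le.2 (hτ ▸ hlt))
  obtain ⟨i, hki, hi, hXi, hother⟩ := (mem_oneLater_iff hk).1 hone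
  rcases thresholdRule_mem_or_eq_one (Λ := Λ) (γ := γ) (N := N) (X := X) (ω := ω) with
    ⟨j, hj1, hj, hτ, hXj, -⟩ | hτ
  · have hkj := hlt j hj1 hτ
    have e : j = i := by
      by_contra hne
      simp [hother j hkj hj hne] at hXj
    subst e
    exact Or.inl ⟨hτ ▸ hT j hj1 hj, j, hj1, hj, hτ, hXj,
      fun l hl hlN => hother l (by omega) hlN (by omega)⟩
  · refine Or.inr (Set.mem_iUnion.2 ⟨i, ⟨by omega, hi, hXi, hτ ▸ hT i (by omega) hi⟩, ?_⟩)
    exact (mem_noneLater_iff hi).2 fun l hl hlN => hother l (by omega) hlN (by omega)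

lemma pairwise_disjoint_passed_inter_noneLater :
    Pairwise (Function.onFun Disjoint fun k => passed N X τ k ∩ noneLater N X k) := by
  refine (pairwise_disjoint_on _).2 fun j k hjk => Set.disjoint_left.2 fun ω h1 h2 => ?_
  obtain ⟨⟨-, hj, -, -⟩, hnone⟩ := h1
  obtain ⟨⟨-, hk, hX, -⟩, -⟩ := h2
  simp [(mem_noneLater_iff hj).1 hnone k hjk hk] at hX

lemma pairwise_disjoint_passed_inter_oneLater :
    Pairwise (Function.onFun Disjoint fun k => passed N X τ k ∩ oneLater N X k) := by
  refine (pairwise_disjoint_on _).2 fun j k hjk => Set.disjoint_left.2 fun ω h1 h2 => ?_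
  obtain ⟨⟨-, hj, -, -⟩, hone⟩ := h1
  obtain ⟨⟨-, hk, hX, -⟩, hone'⟩ := h2
  obtain ⟨i, -, -, -, hother⟩ := (mem_oneLater_iff hj).1 hone
  obtain ⟨l, hkl, hl, hXl, -⟩ := (mem_oneLater_iff hk).1 hone'
  have e1 : k = i := by
    by_contra hne
    simp [hother k hjk hk hne] at hX
  have e2 : l = i := by
    by_contra hne
    simp [hother l (by omega) hl hne] at hXl
  omega

end Pathwise

section Model
variable {Ω : Type*} [mΩ : MeasurableSpace Ω] {P : Measure Ω} [IsProbabilityMeasure P]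
  {θ : ℝ} {Λ : unitInterval → ℝ} {N : unitInterval → Ω → ℕ} {X : ℕ → Ω → Bool}
  {τ : Ω → unitInterval} {γ : ℕ → ℝ}

lemma IsModel.measureReal_winEvent_add_le (h : IsModel P θ Λ N X) (hΛ : Monotone Λ)
    (hΛc : Continuous Λ) (hΛ0 : Λ 0 = 0) (hτ : IsStrategy N X τ) :
    P.real (winEvent N X τ) + P.real (passedLast N X τ)
      ≤ P.real (oneLater N X 0) + P.real (passedSecondLast N X τ) := by
  have hm : MeasurableSet (passedLast N X τ) := MeasurableSet.iUnion fun k =>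
    (h.measurableSet_passed hτ k).inter (h.measurableSet_noneLater k)
  rw [← measureReal_union disjoint_winEvent_passedLast hm]
  refine le_trans ?_ (measureReal_union_le _ _)
  refine ENNReal.toReal_mono (measure_ne_top _ _) (measure_mono_ae ?_)
  filter_upwards [h.poisson.ae_strictMono_arrivalTime hΛ hΛc hΛ0] with ω hω
  exact fun h1 => mem_oneLater_union_passedSecondLast hω.1 h1

lemma IsModel.le_measureReal_winEvent_thresholdRule_add (h : IsModel P θ Λ N X)
    (hΛ : Monotone Λ) (hΛc : Continuous Λ) (hΛ0 : Λ 0 = 0) :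
    P.real (oneLater N X 0) + P.real (passedSecondLast N X (thresholdRule Λ γ N X))
      ≤ P.real (winEvent N X (thresholdRule Λ γ N X))
        + P.real (passedLast N X (thresholdRule Λ γ N X)) := by
  have hτ := h.poisson.isStrategy_thresholdRule (X := X) hΛc γ
  have hm : MeasurableSet (passedSecondLast N X (thresholdRule Λ γ N X)) :=
    MeasurableSet.iUnion fun k =>
      (h.measurableSet_passed hτ k).inter (h.measurableSet_oneLater k)
  rw [← measureReal_union disjoint_oneLater_passedSecondLast hm]
  refine le_trans ?_ (measureReal_union_le _ _)
  refine ENNReal.toReal_mono (measure_ne_top _ _) (measure_mono_ae ?_)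
  filter_upwards [h.poisson.ae_strictMono_arrivalTime hΛ hΛc hΛ0] with ω hω
  exact fun h1 => mem_winEvent_union_passedLast hω.2 h1

/-- The thresholds increase with the number of trials, so the conditional gain from waiting is
nonnegative at all successes passed over by the threshold rule and nonpositive at all others. -/
lemma IsModel.setIntegral_gain_le (h : IsModel P θ Λ N X) (hθ : 0 < θ)
    (hγ : ∀ k : ℕ, 1 ≤ k → IsCriticalRoot θ k (γ k)) (hΛ : Monotone Λ)
    (hΛc : Continuous Λ) (hΛ0 : Λ 0 = 0) (hτ : IsStrategy N X τ) {k : ℕ} (hk : 1 ≤ k) :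
    ∫ ω in passed N X τ k, gain θ Λ k (arrivalTime N k ω) ∂P
      ≤ ∫ ω in passed N X (thresholdRule Λ γ N X) k, gain θ Λ k (arrivalTime N k ω) ∂P := by
  have hτ' := h.poisson.isStrategy_thresholdRule (X := X) hΛc γ
  obtain ⟨-, -, -, hint, -⟩ := h.exists_deviation_bound hθ hΛc hk
  have hm := h.measurableSet_passed hτ k
  have hm' := h.measurableSet_passed hτ' k
  have hγmono : ∀ j, 1 ≤ j → j ≤ k → γ j ≤ γ k := fun j hj hjk =>
    Nat.le_induction (P := fun n _ => γ j ≤ γ n) le_rfl (fun n hn ih => ih.trans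
      ((hγ n (hj.trans hn)).le_succ hθ (hj.trans hn) (hγ (n + 1) (by omega)))) k hjk
  rw [← integral_indicator hm, ← integral_indicator hm']
  refine integral_mono_ae (hint.indicator hm) (hint.indicator hm') ?_
  filter_upwards [h.poisson.ae_strictMono_arrivalTime hΛ hΛc hΛ0] with ω hω
  by_cases h1 : ω ∈ passed N X (thresholdRule Λ γ N X) k
  · have h2 : 0 ≤ gain θ Λ k (arrivalTime N k ω) := by
      obtain ⟨-, hkN, hX, hlt⟩ := h1
      refine mul_nonneg (Real.exp_pos _).le ((hγ k hk).egf_nonneg hθ hk ?_)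
      by_contra! h3
      exact absurd (thresholdRule_le hk hkN hX h3.le) (not_le.2 hlt)
    rw [Set.indicator_of_mem h1]
    by_cases h0 : ω ∈ passed N X τ k
    · rw [Set.indicator_of_mem h0]
    · rwa [Set.indicator_of_notMem h0]
  · rw [Set.indicator_of_notMem h1]
    by_cases h0 : ω ∈ passed N X τ k
    · rw [Set.indicator_of_mem h0]
      obtain ⟨-, hkN, hX, -⟩ := h0
      have hle : thresholdRule Λ γ N X ω ≤ arrivalTime N k ω :=
        not_lt.1 fun hlt => h1 ⟨hk, hkN, hX, hlt⟩
      rcases thresholdRule_mem_or_eq_one (Λ := Λ) (γ := γ) (N := N) (X := X) (ω := ω) with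
        ⟨j, hj1, hj, hτj, -, hγj⟩ | hτ1
      · rw [hτj] at hle
        have hjk : j ≤ k := not_lt.1 fun hkj => not_le.2 (hω.1 k j hkj hj) hle
        refine mul_nonpos_of_nonneg_of_nonpos (Real.exp_pos _).le
          ((hγ k hk).egf_nonpos hθ hk (sub_nonneg.2 (hΛ unitInterval.le_one')) ?_)
        exact (sub_le_sub_left (hΛ hle) _).trans (hγj.trans (hγmono j hj1 hjk))
      · exact absurd (hω.2 k hk hkN) (not_lt.2 (hτ1 ▸ hle))
    · rw [Set.indicator_of_notMem h0]

lemma IsModel.measureReal_winEvent_le (h : IsModel P θ Λ N X) (hθ : 0 < θ)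
    (hγ : ∀ k : ℕ, 1 ≤ k → IsCriticalRoot θ k (γ k)) (hΛ : Monotone Λ)
    (hΛc : Continuous Λ) (hΛ0 : Λ 0 = 0) (hτ : IsStrategy N X τ) :
    P.real (winEvent N X τ) ≤ P.real (winEvent N X (thresholdRule Λ γ N X)) := by
  have hsum : ∀ {σ : Ω → unitInterval}, IsStrategy N X σ → HasSum (fun k =>
      P.real (passed N X σ k ∩ oneLater N X k) - P.real (passed N X σ k ∩ noneLater N X k))
      (P.real (passedSecondLast N X σ) - P.real (passedLast N X σ)) := fun {σ} hσ =>
    (hasSum_measureReal_iUnion pairwise_disjoint_passed_inter_oneLater fun k =>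
      (h.measurableSet_passed hσ k).inter (h.measurableSet_oneLater k)).sub
    (hasSum_measureReal_iUnion pairwise_disjoint_passed_inter_noneLater fun k =>
      (h.measurableSet_passed hσ k).inter (h.measurableSet_noneLater k))
  have hτ' := h.poisson.isStrategy_thresholdRule (X := X) hΛc γ
  have hle := hasSum_le (fun k => ?_) (hsum hτ) (hsum hτ')
  · have h1 := h.measureReal_winEvent_add_le hΛ hΛc hΛ0 hτ
    have h2 := h.le_measureReal_winEvent_thresholdRule_add (γ := γ) hΛ hΛc hΛ0
    linarith
  · by_cases hk : 1 ≤ k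
    · rw [h.measureReal_passed_sub hθ hΛ hΛc hΛ0 hτ hk,
        h.measureReal_passed_sub hθ hΛ hΛc hΛ0 hτ' hk]
      exact h.setIntegral_gain_le hθ hγ hΛ hΛc hΛ0 hτ hk
    · have e : ∀ σ : Ω → unitInterval, passed N X σ k = ∅ := fun σ => by
        ext ω; simp [passed, hk]
      rw [e τ, e]

end Model

end LastSuccess

theorem mainTheorem3 (θ : ℝ) (hθ : 0 < θ) :
    (∀ k : ℕ, 1 ≤ k → ∃! x : ℝ, LastSuccess.IsCriticalRoot θ k x) ∧
    ∀ γ : ℕ → ℝ, (∀ k : ℕ, 1 ≤ k → LastSuccess.IsCriticalRoot θ k (γ k)) →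
      ∀ (Λ : unitInterval → ℝ), Continuous Λ → Monotone Λ → Λ 0 = 0 →
      ∀ {Ω : Type*} [MeasurableSpace Ω] (P : Measure Ω) [IsProbabilityMeasure P]
        (N : unitInterval → Ω → ℕ) (X : ℕ → Ω → Bool), LastSuccess.IsModel P θ Λ N X →
        LastSuccess.IsStrategy N X (LastSuccess.thresholdRule Λ γ N X) ∧
        ∀ τ : Ω → unitInterval, LastSuccess.IsStrategy N X τ →
          P (LastSuccess.winEvent N X τ) ≤
            P (LastSuccess.winEvent N X (LastSuccess.thresholdRule Λ γ N X)) := by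
  refine ⟨fun k hk => ?_, fun γ hγ Λ hΛc hΛ hΛ0 Ω _ P _ N X h =>
    ⟨h.poisson.isStrategy_thresholdRule hΛc γ, fun τ hτ => ?_⟩⟩
  · simp only [LastSuccess.isCriticalRoot_iff hθ hk]
    exact LastSuccess.existsUnique_egf_gainCoeff_eq_zero hθ hk
  · exact (ENNReal.toReal_le_toReal (measure_ne_top _ _) (measure_ne_top _ _)).1
      (h.measureReal_winEvent_le hθ hγ hΛ hΛc hΛ0 hτ)
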